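/- Let $N \geq 1$ be an integer, $\alpha \in (0,N)$, $p,q \geq 1$ and $\theta_1,\theta_2 > 1$ real numbers with $\frac{1}{\theta_1}+\frac{1}{\theta_2}=\frac{N+\alpha}{N}$, and let $$I_\alpha(x)=\frac{\Gamma\left(\frac{N-\alpha}{2}\right)}{\Gamma\left(\frac{\alpha}{2}\right)\pi^{N/2}2^\alpha}\,\frac{1}{|x|^{N-\alpha}},\qquad x\in\mathbb{R}^N\setminus\{0\},$$ be the Riesz potential. Let $(u_n)$ be a bounded sequence in $L^{\theta_1 p}(\mathbb{R}^N)$ and $(v_n)$ a bounded sequence in $L^{\theta_2 q}(\mathbb{R}^N)$ (all functions real-valued, or all complex-valued) such that $u_n\to u$ and $v_n\to v$ almost everywhere in $\mathbb{R}^N$. Then the convolutions $I_\alpha*|u_n|^p$, $I_\alpha*|u_n-u|^p$, $I_\alpha*|u|^p$ converge absolutely almost everywhere, the functions $(I_\alpha*|u_n|^p)|v_n|^q$, $(I_\alpha*|u_n-u|^p)|v_n-v|^q$ and $(I_\alpha*|u|^p)|v|^q$ are integrable on $\mathbb{R}^N$, and $$\lim_{n\to+\infty}\left[\int_{\mathbb{R}^N}(I_\alpha*|u_n|^p)|v_n|^q\,dx-\int_{\mathbb{R}^N}(I_\alpha*|u_n-u|^p)|v_n-v|^q\,dx\right]=\int_{\mathbb{R}^N}(I_\alpha*|u|^p)|v|^q\,dx.$$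 -/

import Mathlib

open MeasureTheory Filter Topology
open scoped Convolution

noncomputable section

/-- The Riesz potential kernel on `ℝ^N`:
`I_α(x) = Γ((N-α)/2) / (Γ(α/2) π^(N/2) 2^α) * 1 / |x|^(N-α)`.
(At the single point `x = 0`, where the kernel is singular, the value is `0` for `α < N`.) -/
def rieszKernel (N : ℕ) (α : ℝ) (x : EuclideanSpace ℝ (Fin N)) : ℝ :=
  Real.Gamma (((N : ℝ) - α) / 2) /
      (Real.Gamma (α / 2) * Real.pi ^ ((N : ℝ) / 2) * (2 : ℝ) ^ α) *
    (1 / ‖x‖ ^ ((N : ℝ) - α))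

/-- The convolution `I_α * f` with respect to Lebesgue measure. -/
def rieszConv (N : ℕ) (α : ℝ) (f : EuclideanSpace ℝ (Fin N) → ℝ) :
    EuclideanSpace ℝ (Fin N) → ℝ :=
  rieszKernel N α ⋆[ContinuousLinearMap.mul ℝ ℝ, volume] f

/-- The function `(I_α * |u|^p) |v|^q`. -/
def choquardDensity {𝕜 : Type*} [RCLike 𝕜] (N : ℕ) (α p q : ℝ)
    (u v : EuclideanSpace ℝ (Fin N) → 𝕜) (x : EuclideanSpace ℝ (Fin N)) : ℝ :=
  rieszConv N α (fun y => ‖u y‖ ^ p) x * ‖v x‖ ^ q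

/-- The integral `∫ (I_α * |u|^p) |v|^q` is meaningful: the integral defining
`(I_α * |u|^p)(x)` converges absolutely for almost every `x`, and the resulting function
`(I_α * |u|^p) |v|^q` is Lebesgue integrable. -/
def ChoquardWellDefined {𝕜 : Type*} [RCLike 𝕜] (N : ℕ) (α p q : ℝ)
    (u v : EuclideanSpace ℝ (Fin N) → 𝕜) : Prop :=
  (∀ᵐ x : EuclideanSpace ℝ (Fin N), ConvolutionExistsAt (rieszKernel N α)
      (fun y => ‖u y‖ ^ p) x (ContinuousLinearMap.mul ℝ ℝ) volume) ∧
    Integrable (choquardDensity N α p q u v) volume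

end

/-! Write `B(f, g) = ∫ (I_α * f) g`. By the Hardy-Littlewood-Sobolev inequality this form is bounded
on `L^θ₁ × L^θ₂`, and it is symmetric because the kernel is even. With `fₙ = |uₙ|^p`, `f⁰ₙ = |uₙ -
u|^p`, `gₙ = |vₙ|^q`, `g⁰ₙ = |vₙ - v|^q`, bilinearity and symmetry give `B(fₙ, gₙ) - B(f⁰ₙ, g⁰ₙ) =
B(fₙ - f⁰ₙ, gₙ) + B(gₙ - g⁰ₙ, f⁰ₙ)`, where the second form on the right has the two exponents
exchanged.

By the Brezis-Lieb lemma (`tendsto_eLpNorm_brezisLieb`), `fₙ - f⁰ₙ → |u|^p` and `gₙ - g⁰ₙ → |v|^q`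
strongly. The other factors `gₙ` and `f⁰ₙ` are bounded and converge almost everywhere to `|v|^q` and
`0`, hence weakly (`tendsto_integral_mul_of_bounded`). Strong against weak convergence
(`tendsto_integral_rieszConv_mul`) sends the right side to `B(|u|^p, |v|^q) + 0`.

The inequality itself is proved for any nonnegative kernel in weak `L^m` uniformly in each variable,
by a layer-cake decomposition of both functions. Its dual form, `exists_rieszConv_bound`, also
yields the absolute convergence of the convolutions. -/

section HardyLittlewoodSobolev

/-! ### Hardy-Littlewood-Sobolev inequality for weak-type kernels, and duality. -/

theorem lintegral_Ioi_rpow_neg {m T : ℝ} (hm : 1 < m) (hT : 0 < T) :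
    ∫⁻ t in Set.Ioi T, ENNReal.ofReal (t ^ (-m)) = ENNReal.ofReal (T ^ (1 - m) / (m - 1)) := by
  rw [← ofReal_integral_eq_lintegral_ofReal, integral_Ioi_rpow_of_lt (by linarith) hT]
  · congr 1
    rw [show -m + 1 = -(m - 1) by ring, neg_div_neg_eq, neg_sub]
  · exact integrableOn_Ioi_rpow_of_lt (by linarith) hT
  · filter_upwards [ae_restrict_mem measurableSet_Ioi] with t ht
    exact Real.rpow_nonneg (hT.trans ht).le _

theorem lintegral_Ioc_rpow {e T : ℝ} (he : -1 < e) (hT : 0 < T) :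
    ∫⁻ t in Set.Ioc 0 T, ENNReal.ofReal (t ^ e) = ENNReal.ofReal (T ^ (e + 1) / (e + 1)) := by
  rw [← ofReal_integral_eq_lintegral_ofReal]
  · rw [← intervalIntegral.integral_of_le hT.le, integral_rpow (Or.inl he),
      Real.zero_rpow (by linarith), sub_zero]
  · exact (intervalIntegrable_iff_integrableOn_Ioc_of_le hT.le).1
      (intervalIntegral.intervalIntegrable_rpow' he)
  · filter_upwards [ae_restrict_mem measurableSet_Ioc] with t ht
    exact Real.rpow_nonneg ht.1.le _

variable {X : Type*} [MeasurableSpace X] {μ : Measure X}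

open scoped ENNReal in
/-- A function in weak `L^m`, `m > 1`, has integral at most `C (μ B) ^ (1 - 1 / m)` over `B`. -/
theorem setLIntegral_le_of_weak_bound {K : X → ℝ} (hK : Measurable K) (hK0 : ∀ x, 0 ≤ K x)
    {m c : ℝ} (hm : 1 < m) (hc : 0 ≤ c)
    (hw : ∀ t, 0 < t → μ {x | t < K x} ≤ ENNReal.ofReal (c * t ^ (-m)))
    (B : Set X) :
    ∫⁻ x in B, ENNReal.ofReal (K x) ∂μ ≤
      ENNReal.ofReal (1 + c / (m - 1)) * μ B ^ (1 - 1 / m) := by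
  have hm0 : 0 < m := by linarith
  have hm1 : 0 < m - 1 := by linarith
  have hs : 0 < 1 - 1 / m := by
    rw [sub_pos, div_lt_one hm0]; exact hm
  have hC : 0 < 1 + c / (m - 1) := by positivity
  rcases eq_or_ne (μ B) 0 with h0 | h0
  · rw [Measure.restrict_eq_zero.2 h0]; simp
  rcases eq_or_ne (μ B) ∞ with ht | ht
  · rw [ht, ENNReal.top_rpow_of_pos hs, ENNReal.mul_top (by simpa using hC)]
    exact le_top
  set M := (μ B).toReal with hM
  have hM0 : 0 < M := ENNReal.toReal_pos h0 ht
  have hMB : μ B = ENNReal.ofReal M := (ENNReal.ofReal_toReal ht).symm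
  -- This height balances the two estimates: the trivial bound `μ B` on levels below `T` contributes
  -- `M * T`, the weak bound above it `c * T ^ (1 - m) / (m - 1)`, and both scale like `M ^ (1 - 1 /
  -- m)`.
  set T := M ^ (-(1 / m)) with hT
  have hT0 : 0 < T := Real.rpow_pos_of_pos hM0 _
  rw [lintegral_eq_lintegral_meas_lt _ (Eventually.of_forall hK0) hK.aemeasurable,
    ← Set.Ioc_union_Ioi_eq_Ioi hT0.le,
    lintegral_union measurableSet_Ioi (Set.Ioc_disjoint_Ioi le_rfl)]
  have h1 : ∫⁻ t in Set.Ioc 0 T, μ.restrict B {x | t < K x} ≤ ENNReal.ofReal (M * T) := by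
    calc _ ≤ ∫⁻ _ in Set.Ioc 0 T, μ B := by
          refine lintegral_mono fun t => ?_
          calc _ ≤ μ.restrict B Set.univ := measure_mono (Set.subset_univ _)
            _ = μ B := by simp
      _ = _ := by
          rw [setLIntegral_const, Real.volume_Ioc, hMB, ← ENNReal.ofReal_mul hM0.le, sub_zero]
  have h2 : ∫⁻ t in Set.Ioi T, μ.restrict B {x | t < K x} ≤
      ENNReal.ofReal (c * (T ^ (1 - m) / (m - 1))) := by
    calc _ ≤ ∫⁻ t in Set.Ioi T, ENNReal.ofReal c * ENNReal.ofReal (t ^ (-m)) := by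
          refine setLIntegral_mono' measurableSet_Ioi fun t ht => ?_
          rw [← ENNReal.ofReal_mul hc]
          exact (Measure.restrict_apply_le _ _).trans (hw t (hT0.trans ht))
      _ = _ := by
          rw [lintegral_const_mul' _ _ ENNReal.ofReal_ne_top, lintegral_Ioi_rpow_neg hm hT0,
            ← ENNReal.ofReal_mul hc]
  refine (add_le_add h1 h2).trans ?_
  have e1 : M * T = M ^ (1 - 1 / m) := by
    rw [hT, ← Real.rpow_one_add' hM0.le (by linarith)]; ring_nf
  have e2 : T ^ (1 - m) = M ^ (1 - 1 / m) := by
    rw [hT, ← Real.rpow_mul hM0.le]; congr 1; field_simp; ring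
  rw [← ENNReal.ofReal_add (by positivity) (by positivity), e1, e2, hMB,
    ENNReal.ofReal_rpow_of_pos hM0, ← ENNReal.ofReal_mul hC.le]
  apply le_of_eq
  congr 1
  ring

theorem meas_lt_le_of_lintegral_rpow_le_one {f : X → ℝ}
    (hf : Measurable f) {p : ℝ} (hp : 0 < p)
    (h : ∫⁻ x, ENNReal.ofReal (f x ^ p) ∂μ ≤ 1) {t : ℝ} (ht : 0 < t) :
    μ {x | t < f x} ≤ ENNReal.ofReal (t ^ (-p)) := by
  have h1 := mul_meas_ge_le_lintegral₀ (μ := μ)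
    (f := fun x => ENNReal.ofReal (f x ^ p)) (by fun_prop) (ENNReal.ofReal (t ^ p))
  have h2 : μ {x | t < f x} ≤ μ {x | ENNReal.ofReal (t ^ p) ≤ ENNReal.ofReal (f x ^ p)} := by
    refine measure_mono fun x hx => ENNReal.ofReal_le_ofReal ?_
    exact Real.rpow_le_rpow ht.le (le_of_lt hx) hp.le
  have h3 : 0 < t ^ p := Real.rpow_pos_of_pos ht _
  rw [Real.rpow_neg ht.le, ENNReal.ofReal_inv_of_pos h3]
  refine h2.trans ?_
  rw [ENNReal.le_inv_iff_mul_le, mul_comm]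
  exact h1.trans h

/-- The half of the Hardy-Littlewood-Sobolev estimate in which the level of `h` is small compared
with the level of `f`. -/
theorem lintegral_levels_le {Y : Type*} [MeasurableSpace Y] {ν : Measure Y}
    {f : X → ℝ} {h : Y → ℝ} (hf0 : ∀ x, 0 ≤ f x)
    (hf : Measurable f) (hh : Measurable h) {p r s : ℝ} (hp : 1 < p)
    (hr : 1 < r) (hs : 0 < s) (hprs : 1 / p + 1 / r = 1 + s)
    (hfp : ∫⁻ x, ENNReal.ofReal (f x ^ p) ∂μ ≤ 1) (hhr : ∫⁻ x, ENNReal.ofReal (h x ^ r) ∂ν ≤ 1) :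
    ∫⁻ a in Set.Ioi (0 : ℝ), ∫⁻ b in Set.Ioc 0 (a ^ (p / r)),
      μ {x | a < f x} * ν {y | b < h y} ^ s ≤ ENNReal.ofReal (1 / (r - r / p)) := by
  have hp0 : 0 < p := by linarith
  have hr0 : 0 < r := by linarith
  have hrs : 1 - r * s = r - r / p := by
    have : s = 1 / p + 1 / r - 1 := by linarith
    rw [this]; field_simp; ring
  have hpos : 0 < r - r / p := by
    rw [sub_pos, div_lt_iff₀ hp0]; nlinarith
  -- Chebyshev bounds the integrand in `b` by `b ^ (-(r * s))`, integrable at `0` since `1 - r * s =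
  -- r - r / p > 0`. The cut-off `a ^ (p / r)` is chosen so that the result is a multiple of `a ^ (p
  -- - 1)`, the layer-cake weight of `∫ f ^ p`.
  have key : ∀ a ∈ Set.Ioi (0 : ℝ), ∫⁻ b in Set.Ioc 0 (a ^ (p / r)),
      μ {x | a < f x} * ν {y | b < h y} ^ s ≤
      μ {x | a < f x} * ENNReal.ofReal (a ^ (p - 1)) * ENNReal.ofReal (1 / (r - r / p)) := by
    intro a ha
    have ha0 : (0 : ℝ) < a := ha
    have hfin : μ {x | a < f x} ≠ ⊤ :=
      ((meas_lt_le_of_lintegral_rpow_le_one hf hp0 hfp ha).trans_lt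
        ENNReal.ofReal_lt_top).ne
    rw [lintegral_const_mul' _ _ hfin, mul_assoc]
    gcongr
    calc _ ≤ ∫⁻ b in Set.Ioc 0 (a ^ (p / r)), ENNReal.ofReal (b ^ (-(r * s))) := by
          refine setLIntegral_mono' measurableSet_Ioc fun b hb => ?_
          calc _ ≤ (ENNReal.ofReal (b ^ (-r))) ^ s := ENNReal.rpow_le_rpow
                (meas_lt_le_of_lintegral_rpow_le_one hh hr0 hhr hb.1) hs.le
            _ = _ := by
              rw [ENNReal.ofReal_rpow_of_pos (Real.rpow_pos_of_pos hb.1 _),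
                ← Real.rpow_mul hb.1.le, neg_mul]
      _ = _ := by
          rw [lintegral_Ioc_rpow (by linarith) (Real.rpow_pos_of_pos ha0 _),
            show -(r * s) + 1 = r - r / p by linarith, ← Real.rpow_mul ha0.le,
            show p / r * (r - r / p) = p - 1 by field_simp,
            ← ENNReal.ofReal_mul (Real.rpow_nonneg ha0.le _), mul_one_div]
  refine (setLIntegral_mono' measurableSet_Ioi key).trans ?_
  rw [lintegral_mul_const' _ _ ENNReal.ofReal_ne_top]
  have h1 := lintegral_rpow_eq_lintegral_meas_lt_mul μ (Eventually.of_forall hf0) hf.aemeasurable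
    hp0
  have h2 : ∫⁻ a in Set.Ioi (0 : ℝ), μ {x | a < f x} * ENNReal.ofReal (a ^ (p - 1)) ≤ 1 := by
    refine le_trans ?_ hfp
    rw [h1]
    exact le_mul_of_one_le_left' (by simpa using hp.le)
  calc _ ≤ 1 * ENNReal.ofReal (1 / (r - r / p)) := by gcongr
    _ = _ := one_mul _

open scoped ENNReal in
-- This is the layer-cake formula for `f` with respect to the measure of density `G`.
theorem lintegral_mul_eq_lintegral_setLIntegral_meas_lt {f : X → ℝ} (hf0 : ∀ x, 0 ≤ f x)
    (hf : Measurable f) {G : X → ℝ≥0∞} (hG : Measurable G) :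
    ∫⁻ x, ENNReal.ofReal (f x) * G x ∂μ =
      ∫⁻ a in Set.Ioi (0 : ℝ), ∫⁻ x in {x | a < f x}, G x ∂μ := by
  have h := lintegral_eq_lintegral_meas_lt (μ.withDensity G) (Eventually.of_forall hf0)
    hf.aemeasurable
  rw [lintegral_withDensity_eq_lintegral_mul _ hG (by fun_prop)] at h
  calc _ = ∫⁻ x, (G * fun x => ENNReal.ofReal (f x)) x ∂μ := by
        refine lintegral_congr fun x => ?_
        simp [mul_comm]
    _ = _ := by
        rw [h]
        refine lintegral_congr fun a => ?_
        rw [withDensity_apply _ (measurableSet_lt measurable_const hf)]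

/-- The Hardy-Littlewood-Sobolev inequality for a kernel in weak `L^m`, uniformly in each variable,
with normalized functions. -/
theorem hardyLittlewoodSobolev_normalized [SFinite μ] {k : X → X → ℝ}
    (hk : Measurable (Function.uncurry k)) (hk0 : ∀ x y, 0 ≤ k x y)
    {m c : ℝ} (hm : 1 < m) (hc : 0 ≤ c)
    (hw₁ : ∀ x t, 0 < t → μ {y | t < k x y} ≤ ENNReal.ofReal (c * t ^ (-m)))
    (hw₂ : ∀ y t, 0 < t → μ {x | t < k x y} ≤ ENNReal.ofReal (c * t ^ (-m)))
    {p r : ℝ} (hp : 1 < p) (hr : 1 < r) (hpr : 1 / p + 1 / r + 1 / m = 2)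
    {f h : X → ℝ} (hf0 : ∀ x, 0 ≤ f x) (hf : Measurable f) (hh0 : ∀ x, 0 ≤ h x)
    (hh : Measurable h)
    (hfp : ∫⁻ x, ENNReal.ofReal (f x ^ p) ∂μ ≤ 1) (hhr : ∫⁻ x, ENNReal.ofReal (h x ^ r) ∂μ ≤ 1) :
    ∫⁻ y, ENNReal.ofReal (h y) * ∫⁻ x, ENNReal.ofReal (f x) * ENNReal.ofReal (k x y) ∂μ ∂μ ≤
      ENNReal.ofReal ((1 + c / (m - 1)) * (1 / (r - r / p) + 1 / (p - p / r))) := by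
  have hp0 : 0 < p := by linarith
  have hr0 : 0 < r := by linarith
  have hm0 : 0 < m := by linarith
  have hs : 0 < 1 - 1 / m := by
    rw [sub_pos, div_lt_one hm0]; exact hm
  have hpr' : 0 < r - r / p := by
    rw [sub_pos, div_lt_iff₀ hp0]; nlinarith
  have hrp' : 0 < p - p / r := by
    rw [sub_pos, div_lt_iff₀ hr0]; nlinarith
  have hC : 0 ≤ 1 + c / (m - 1) := by
    have : 0 < m - 1 := by linarith
    positivity
  set s := 1 - 1 / m with hsdef
  set C := ENNReal.ofReal (1 + c / (m - 1)) with hCdef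
  have hkx : ∀ x, Measurable (k x) := fun x => hk.comp measurable_prodMk_left
  have hky : ∀ y, Measurable fun x => k x y := fun y => hk.comp measurable_prodMk_right
  have hko : Measurable (Function.uncurry fun x y => ENNReal.ofReal (k x y)) := hk.ennreal_ofReal
  have hko' : Measurable (Function.uncurry fun y x => ENNReal.ofReal (k x y)) :=
    hko.comp measurable_swap
  set v : ℝ → ENNReal := fun a => μ {x | a < f x} with hv
  set w : ℝ → ENNReal := fun b => μ {x | b < h x} with hw
  have hvm : Measurable v :=
    Antitone.measurable fun a b hab => measure_mono fun x hx => lt_of_le_of_lt hab hx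
  have hwm : Measurable w :=
    Antitone.measurable fun a b hab => measure_mono fun x hx => lt_of_le_of_lt hab hx
  -- The kernel integral over a product of superlevel sets is bounded in two ways, according to
  -- which variable absorbs the weak-type estimate. Each bound is summable on one side of the curve
  -- `b = a ^ (p / r)`.
  have hJ₁ : ∀ a b, ∫⁻ y in {y | b < h y}, ∫⁻ x in {x | a < f x}, ENNReal.ofReal (k x y) ∂μ ∂μ ≤
      C * (w b * v a ^ s) := by
    intro a b
    calc _ ≤ ∫⁻ y in {y | b < h y}, C * v a ^ s ∂μ := lintegral_mono fun y =>
          setLIntegral_le_of_weak_bound (hky y) (fun x => hk0 x y) hm hc (hw₂ y) _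
      _ = _ := by rw [setLIntegral_const]; ring
  have hJ₂ : ∀ a b, ∫⁻ y in {y | b < h y}, ∫⁻ x in {x | a < f x}, ENNReal.ofReal (k x y) ∂μ ∂μ ≤
      C * (v a * w b ^ s) := by
    intro a b
    rw [lintegral_lintegral_swap hko'.aemeasurable]
    calc _ ≤ ∫⁻ x in {x | a < f x}, C * w b ^ s ∂μ := lintegral_mono fun x =>
          setLIntegral_le_of_weak_bound (hkx x) (hk0 x) hm hc (hw₁ x) _
      _ = _ := by rw [setLIntegral_const]; ring
  have hI : ∫⁻ y, ENNReal.ofReal (h y) * ∫⁻ x, ENNReal.ofReal (f x) * ENNReal.ofReal (k x y) ∂μ ∂μ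
      = ∫⁻ a in Set.Ioi (0 : ℝ), ∫⁻ b in Set.Ioi (0 : ℝ), ∫⁻ y in {y | b < h y},
        ∫⁻ x in {x | a < f x}, ENNReal.ofReal (k x y) ∂μ ∂μ := by
    have hin : ∀ y, ENNReal.ofReal (h y) * ∫⁻ x, ENNReal.ofReal (f x) * ENNReal.ofReal (k x y) ∂μ =
        ∫⁻ x, ENNReal.ofReal (f x) * (ENNReal.ofReal (h y) * ENNReal.ofReal (k x y)) ∂μ := by
      intro y
      rw [← lintegral_const_mul' _ _ ENNReal.ofReal_ne_top]
      exact lintegral_congr fun x => by ring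
    simp_rw [hin]
    have hm1 : Measurable (Function.uncurry fun y x =>
        ENNReal.ofReal (h y) * ENNReal.ofReal (k x y)) :=
      (hh.ennreal_ofReal.comp measurable_fst).mul (hko.comp measurable_swap)
    have hm2 : Measurable (Function.uncurry fun y x =>
        ENNReal.ofReal (f x) * (ENNReal.ofReal (h y) * ENNReal.ofReal (k x y))) :=
      (hf.ennreal_ofReal.comp measurable_snd).mul hm1
    have hm1' : Measurable (Function.uncurry fun x y =>
        ENNReal.ofReal (h y) * ENNReal.ofReal (k x y)) := hm1.comp measurable_swap
    rw [lintegral_lintegral_swap hm2.aemeasurable]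
    simp_rw [lintegral_const_mul' _ _ ENNReal.ofReal_ne_top]
    rw [lintegral_mul_eq_lintegral_setLIntegral_meas_lt hf0 hf
      hm1'.lintegral_prod_right]
    refine lintegral_congr fun a => ?_
    rw [lintegral_lintegral_swap hm1'.aemeasurable]
    simp_rw [lintegral_const_mul' _ _ ENNReal.ofReal_ne_top]
    rw [lintegral_mul_eq_lintegral_setLIntegral_meas_lt hh0 hh
      hko'.lintegral_prod_right]
  have hA := lintegral_levels_le (μ := μ) (ν := μ) hf0 hf hh hp hr hs (by linarith) hfp hhr
  have hB := lintegral_levels_le (μ := μ) (ν := μ) hh0 hh hf hr hp hs (by linarith) hhr hfp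
  have hB' : ∫⁻ a in Set.Ioi (0 : ℝ), ∫⁻ b in Set.Ioi (a ^ (p / r)), w b * v a ^ s ≤
      ENNReal.ofReal (1 / (p - p / r)) := by
    refine le_trans ?_ hB
    -- The region `a ^ (p / r) < b` lies in `a ≤ b ^ (r / p)`. After Tonelli this is the region of
    -- `lintegral_levels_le` with the two functions exchanged.
    have e1 : ∀ a ∈ Set.Ioi (0 : ℝ), ∫⁻ b in Set.Ioi (a ^ (p / r)), w b * v a ^ s ≤
        ∫⁻ b in Set.Ioi (0 : ℝ),
          {z : ℝ × ℝ | z.1 ≤ z.2 ^ (r / p)}.indicator (fun z => w z.2 * v z.1 ^ s) (a, b) := by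
      intro a ha
      have ha0 : (0 : ℝ) < a := ha
      rw [← lintegral_indicator measurableSet_Ioi, ← lintegral_indicator measurableSet_Ioi]
      refine lintegral_mono fun b => ?_
      by_cases hb : a ^ (p / r) < b
      · have hb0 : 0 < b := (Real.rpow_pos_of_pos ha0 _).trans hb
        have hab : a ≤ b ^ (r / p) := by
          have := Real.rpow_le_rpow (Real.rpow_nonneg ha0.le _) hb.le (by positivity : 0 ≤ r / p)
          rwa [← Real.rpow_mul ha0.le, show p / r * (r / p) = 1 by field_simp,
            Real.rpow_one] at this
        simp [Set.indicator, hb, hb0, hab]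
      · simp [Set.indicator, hb]
    have hmeas : MeasurableSet {z : ℝ × ℝ | z.1 ≤ z.2 ^ (r / p)} :=
      measurableSet_le measurable_fst (by fun_prop)
    refine (setLIntegral_mono' measurableSet_Ioi e1).trans ?_
    rw [lintegral_lintegral_swap]
    · refine setLIntegral_mono' measurableSet_Ioi fun b hb => ?_
      rw [← lintegral_indicator measurableSet_Ioi, ← lintegral_indicator measurableSet_Ioc]
      refine lintegral_mono fun a => ?_
      by_cases ha : 0 < a <;> by_cases hab : a ≤ b ^ (r / p) <;>
        simp [Set.indicator, ha, hab, v, w]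
    · exact (((hwm.comp measurable_snd).mul ((hvm.comp measurable_fst).pow_const s)).indicator
        hmeas).aemeasurable
  rw [hI]
  calc _ ≤ ∫⁻ a in Set.Ioi (0 : ℝ), (C * ∫⁻ b in Set.Ioc 0 (a ^ (p / r)), v a * w b ^ s) +
        C * ∫⁻ b in Set.Ioi (a ^ (p / r)), w b * v a ^ s := by
        refine setLIntegral_mono' measurableSet_Ioi fun a ha => ?_
        have ha0 : (0 : ℝ) < a := ha
        rw [← Set.Ioc_union_Ioi_eq_Ioi (Real.rpow_nonneg ha0.le (p / r)),
          lintegral_union measurableSet_Ioi (Set.Ioc_disjoint_Ioi le_rfl),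
          ← lintegral_const_mul' _ _ ENNReal.ofReal_ne_top,
          ← lintegral_const_mul' _ _ ENNReal.ofReal_ne_top]
        exact add_le_add (lintegral_mono fun b => hJ₂ a b) (lintegral_mono fun b => hJ₁ a b)
    _ ≤ (C * ENNReal.ofReal (1 / (r - r / p))) + C * ENNReal.ofReal (1 / (p - p / r)) := by
        rw [lintegral_add_right', lintegral_const_mul' _ _ ENNReal.ofReal_ne_top,
          lintegral_const_mul' _ _ ENNReal.ofReal_ne_top]
        · gcongr
        · refine AEMeasurable.const_mul ?_ _
          have hset : MeasurableSet {z : ℝ × ℝ | z.1 ^ (p / r) < z.2} :=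
            measurableSet_lt (by fun_prop) measurable_snd
          have : Measurable fun a : ℝ => ∫⁻ b, {z : ℝ × ℝ | z.1 ^ (p / r) < z.2}.indicator
              (fun z => w z.2 * v z.1 ^ s) (a, b) :=
            (((hwm.comp measurable_snd).mul
              ((hvm.comp measurable_fst).pow_const s)).indicator hset).lintegral_prod_right'
          refine this.aemeasurable.congr (Eventually.of_forall fun a => ?_)
          dsimp only
          rw [← lintegral_indicator measurableSet_Ioi]
          rfl
    _ = _ := by
        rw [← mul_add, ← ENNReal.ofReal_add (by positivity) (by positivity),
          ← ENNReal.ofReal_mul hC]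

/-- The Hardy-Littlewood-Sobolev inequality for a kernel in weak `L^m`, uniformly in each
variable. -/
theorem hardyLittlewoodSobolev [SFinite μ] {k : X → X → ℝ}
    (hk : Measurable (Function.uncurry k)) (hk0 : ∀ x y, 0 ≤ k x y)
    {m c : ℝ} (hm : 1 < m) (hc : 0 ≤ c)
    (hw₁ : ∀ x t, 0 < t → μ {y | t < k x y} ≤ ENNReal.ofReal (c * t ^ (-m)))
    (hw₂ : ∀ y t, 0 < t → μ {x | t < k x y} ≤ ENNReal.ofReal (c * t ^ (-m)))
    {p r : ℝ} (hp : 1 < p) (hr : 1 < r) (hpr : 1 / p + 1 / r + 1 / m = 2) :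
    ∃ C : ℝ, 0 ≤ C ∧ ∀ (f h : X → ℝ) (a b : ℝ), 0 < a → 0 < b → (∀ x, 0 ≤ f x) → Measurable f →
      (∀ x, 0 ≤ h x) → Measurable h →
      ∫⁻ x, ENNReal.ofReal (f x ^ p) ∂μ ≤ ENNReal.ofReal (a ^ p) →
      ∫⁻ x, ENNReal.ofReal (h x ^ r) ∂μ ≤ ENNReal.ofReal (b ^ r) →
      ∫⁻ y, ENNReal.ofReal (h y) * ∫⁻ x, ENNReal.ofReal (f x) * ENNReal.ofReal (k x y) ∂μ ∂μ ≤
        ENNReal.ofReal (C * a * b) := by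
  have hC : 0 ≤ (1 + c / (m - 1)) * (1 / (r - r / p) + 1 / (p - p / r)) := by
    have : 0 < m - 1 := by linarith
    have hpr' : 0 < r - r / p := by
      rw [sub_pos, div_lt_iff₀ (by linarith)]; nlinarith
    have hrp' : 0 < p - p / r := by
      rw [sub_pos, div_lt_iff₀ (by linarith)]; nlinarith
    positivity
  refine ⟨_, hC, fun f h a b ha hb hf0 hf hh0 hh hfp hhr => ?_⟩
  have hscale : ∀ {g : X → ℝ} {a q : ℝ}, 0 < a → (∀ x, 0 ≤ g x) →
      ∫⁻ x, ENNReal.ofReal (g x ^ q) ∂μ ≤ ENNReal.ofReal (a ^ q) →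
      ∫⁻ x, ENNReal.ofReal ((a⁻¹ * g x) ^ q) ∂μ ≤ 1 := by
    intro g a q ha hg h
    have h1 : 0 < a ^ q := Real.rpow_pos_of_pos ha _
    calc _ = ∫⁻ x, ENNReal.ofReal (a ^ q)⁻¹ * ENNReal.ofReal (g x ^ q) ∂μ := by
          refine lintegral_congr fun x => ?_
          rw [← ENNReal.ofReal_mul (by positivity), Real.mul_rpow (by positivity) (hg x),
            Real.inv_rpow ha.le]
      _ ≤ ENNReal.ofReal (a ^ q)⁻¹ * ENNReal.ofReal (a ^ q) := by
          rw [lintegral_const_mul' _ _ ENNReal.ofReal_ne_top]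
          gcongr
      _ = 1 := by
          rw [← ENNReal.ofReal_mul (by positivity), inv_mul_cancel₀ h1.ne', ENNReal.ofReal_one]
  have key := hardyLittlewoodSobolev_normalized hk hk0 hm hc hw₁ hw₂ hp hr hpr
    (f := fun x => a⁻¹ * f x) (h := fun x => b⁻¹ * h x)
    (fun x => mul_nonneg (by positivity) (hf0 x)) (hf.const_mul _)
    (fun x => mul_nonneg (by positivity) (hh0 x)) (hh.const_mul _)
    (hscale ha hf0 hfp) (hscale hb hh0 hhr)
  have ha' : 0 ≤ a⁻¹ := by positivity
  have hb' : 0 ≤ b⁻¹ := by positivity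
  have e : ∀ y, ENNReal.ofReal (b⁻¹ * h y) *
      ∫⁻ x, ENNReal.ofReal (a⁻¹ * f x) * ENNReal.ofReal (k x y) ∂μ =
      ENNReal.ofReal (b⁻¹ * a⁻¹) * (ENNReal.ofReal (h y) *
        ∫⁻ x, ENNReal.ofReal (f x) * ENNReal.ofReal (k x y) ∂μ) := by
    intro y
    simp_rw [ENNReal.ofReal_mul ha', ENNReal.ofReal_mul hb', mul_assoc]
    rw [lintegral_const_mul' _ _ ENNReal.ofReal_ne_top]
    ring
  simp_rw [e] at key
  rw [lintegral_const_mul' _ _ ENNReal.ofReal_ne_top] at key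
  calc _ = ENNReal.ofReal (a * b) * (ENNReal.ofReal (b⁻¹ * a⁻¹) * ∫⁻ y, ENNReal.ofReal (h y) *
        ∫⁻ x, ENNReal.ofReal (f x) * ENNReal.ofReal (k x y) ∂μ ∂μ) := by
        rw [← mul_assoc, ← ENNReal.ofReal_mul (by positivity)]
        have : a * b * (b⁻¹ * a⁻¹) = 1 := by field_simp
        simp [this]
    _ ≤ ENNReal.ofReal (a * b) * _ := mul_le_mul_right key _
    _ = _ := by
        rw [← ENNReal.ofReal_mul (by positivity)]
        congr 1
        ring

open scoped ENNReal in
/-- Converse of Hölder's inequality. -/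
theorem lintegral_rpow_le_of_forall_lintegral_mul_le [SigmaFinite μ] {H : X → ℝ≥0∞}
    (hH : Measurable H) {r r' D : ℝ} (hr : r.HolderConjugate r') (hD : 0 ≤ D)
    (h : ∀ (g : X → ℝ) (b : ℝ), 0 < b → (∀ x, 0 ≤ g x) → Measurable g →
      ∫⁻ x, ENNReal.ofReal (g x ^ r) ∂μ ≤ ENNReal.ofReal (b ^ r) →
      ∫⁻ x, ENNReal.ofReal (g x) * H x ∂μ ≤ ENNReal.ofReal (D * b)) :
    ∫⁻ x, H x ^ r' ∂μ ≤ ENNReal.ofReal (D ^ r') := by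
  have hr0 := hr.pos
  have hr'0 := hr.symm.pos
  -- Truncating in height and to sets of finite measure makes the `r'`-integral finite, so that a
  -- power of it can be divided out below; Fatou's lemma removes the truncation.
  set G : ℕ → X → ℝ := fun n => (spanningSets μ n).indicator fun x => (min (H x) n).toReal with hG
  have hGm : ∀ n, Measurable (G n) := fun n =>
    (hH.min measurable_const).ennreal_toReal.indicator (measurableSet_spanningSets μ n)
  have hG0 : ∀ n x, 0 ≤ G n x := fun n x => Set.indicator_nonneg (fun _ _ => ENNReal.toReal_nonneg) _
  have hGH : ∀ n x, ENNReal.ofReal (G n x) ≤ H x := by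
    intro n x
    by_cases hx : x ∈ spanningSets μ n
    · simp only [hG, Set.indicator_of_mem hx]
      exact ENNReal.ofReal_toReal_le.trans (min_le_left _ _)
    · simp [hG, Set.indicator_of_notMem hx]
  have hbound : ∀ n, ∫⁻ x, ENNReal.ofReal (G n x ^ r') ∂μ ≤ ENNReal.ofReal (D ^ r') := by
    intro n
    have hfin : ∫⁻ x, ENNReal.ofReal (G n x ^ r') ∂μ ≠ ∞ := by
      refine ne_of_lt (lt_of_le_of_lt (b := ∫⁻ x in spanningSets μ n,
        ENNReal.ofReal ((n : ℝ) ^ r') ∂μ) ?_ ?_)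
      · rw [← lintegral_indicator (measurableSet_spanningSets μ n)]
        refine lintegral_mono fun x => ?_
        by_cases hx : x ∈ spanningSets μ n
        · simp only [hG, Set.indicator_of_mem hx]
          refine ENNReal.ofReal_le_ofReal (Real.rpow_le_rpow ENNReal.toReal_nonneg ?_ hr'0.le)
          exact ENNReal.toReal_le_of_le_ofReal (Nat.cast_nonneg n) (by simp)
        · simp [hG, Set.indicator_of_notMem hx, Real.zero_rpow hr'0.ne']
      · rw [setLIntegral_const]
        exact ENNReal.mul_lt_top ENNReal.ofReal_lt_top (measure_spanningSets_lt_top μ n)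
    rcases eq_or_ne (∫⁻ x, ENNReal.ofReal (G n x ^ r') ∂μ) 0 with h0 | h0
    · rw [h0]; exact zero_le
    set A := (∫⁻ x, ENNReal.ofReal (G n x ^ r') ∂μ).toReal with hA
    have hA0 : 0 < A := ENNReal.toReal_pos h0 hfin
    have hAe : ∫⁻ x, ENNReal.ofReal (G n x ^ r') ∂μ = ENNReal.ofReal A :=
      (ENNReal.ofReal_toReal hfin).symm
    -- The extremal test function of Hölder's inequality: its `r`-th power is `G n ^ r'`, so its
    -- `L^r` norm is `A ^ (1 / r)`.
    have h1 := h (fun x => G n x ^ (r' - 1)) (A ^ (1 / r)) (Real.rpow_pos_of_pos hA0 _)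
      (fun x => Real.rpow_nonneg (hG0 n x) _) ((hGm n).pow_const _) (by
        rw [← Real.rpow_mul hA0.le, one_div_mul_cancel hr0.ne', Real.rpow_one, ← hAe]
        refine le_of_eq (lintegral_congr fun x => ?_)
        rw [← Real.rpow_mul (hG0 n x), hr.symm.sub_one_mul_conj])
    have h2 : ENNReal.ofReal A ≤ ENNReal.ofReal (D * A ^ (1 / r)) := by
      refine le_trans ?_ h1
      rw [← hAe]
      refine lintegral_mono fun x => ?_
      calc ENNReal.ofReal (G n x ^ r') = ENNReal.ofReal (G n x ^ (r' - 1)) *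
            ENNReal.ofReal (G n x) := by
            rw [← ENNReal.ofReal_mul (Real.rpow_nonneg (hG0 n x) _),
              ← Real.rpow_add_one' (hG0 n x) (by linarith), sub_add_cancel]
        _ ≤ _ := by gcongr; exact hGH n x
    rw [hAe]
    refine ENNReal.ofReal_le_ofReal ?_
    have h3 : A ≤ D * A ^ (1 / r) := (ENNReal.ofReal_le_ofReal_iff (by positivity)).1 h2
    have h4 : A ^ (1 / r') ≤ D := by
      have : A = A ^ (1 / r') * A ^ (1 / r) := by
        rw [← Real.rpow_add hA0, add_comm, one_div, one_div, hr.inv_add_inv_eq_one, Real.rpow_one]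
      exact le_of_mul_le_mul_right (this ▸ h3 : A ^ (1 / r') * A ^ (1 / r) ≤ _)
        (Real.rpow_pos_of_pos hA0 _)
    calc A = (A ^ (1 / r')) ^ r' := by
          rw [← Real.rpow_mul hA0.le, one_div_mul_cancel hr'0.ne', Real.rpow_one]
      _ ≤ D ^ r' := Real.rpow_le_rpow (by positivity) h4 hr'0.le
  have hlim : ∀ x, Tendsto (fun n => ENNReal.ofReal (G n x ^ r')) atTop (𝓝 (H x ^ r')) := by
    intro x
    have h1 : Tendsto (fun n : ℕ => min (H x) n) atTop (𝓝 (H x)) := by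
      have := (tendsto_const_nhds (x := H x) (f := (atTop : Filter ℕ))).min
        ENNReal.tendsto_nat_nhds_top
      simpa using this
    have h2 : Tendsto (fun n : ℕ => min (H x) n ^ r') atTop (𝓝 (H x ^ r')) :=
      (ENNReal.continuous_rpow_const.tendsto _).comp h1
    refine h2.congr' ?_
    obtain ⟨N, hN⟩ : ∃ N, x ∈ spanningSets μ N := by
      have := iUnion_spanningSets μ ▸ Set.mem_univ x
      exact Set.mem_iUnion.1 this
    filter_upwards [eventually_ge_atTop N] with n hn
    have hx : x ∈ spanningSets μ n := monotone_spanningSets μ hn hN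
    simp only [hG, Set.indicator_of_mem hx]
    rw [← ENNReal.ofReal_rpow_of_nonneg ENNReal.toReal_nonneg hr'0.le, ENNReal.ofReal_toReal]
    exact ne_of_lt ((min_le_right _ _).trans_lt (ENNReal.natCast_lt_top n))
  calc ∫⁻ x, H x ^ r' ∂μ = ∫⁻ x, liminf (fun n => ENNReal.ofReal (G n x ^ r')) atTop ∂μ :=
        lintegral_congr fun x => (hlim x).liminf_eq.symm
    _ ≤ liminf (fun n => ∫⁻ x, ENNReal.ofReal (G n x ^ r') ∂μ) atTop :=
        lintegral_liminf_le fun n => ((hGm n).pow_const _).ennreal_ofReal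
    _ ≤ liminf (fun _ : ℕ => ENNReal.ofReal (D ^ r')) atTop :=
        liminf_le_liminf (Eventually.of_forall hbound)
    _ = _ := liminf_const _

end HardyLittlewoodSobolev

/-! ### The Riesz kernel and the mapping properties of its potential. -/

section RieszKernel

variable {N : ℕ} {α : ℝ}

theorem rieszKernel_const_pos (hα₀ : 0 < α) (hαN : α < (N : ℝ)) :
    0 < Real.Gamma (((N : ℝ) - α) / 2) /
      (Real.Gamma (α / 2) * Real.pi ^ ((N : ℝ) / 2) * (2 : ℝ) ^ α) := by
  have h1 := Real.Gamma_pos_of_pos (show 0 < ((N : ℝ) - α) / 2 by linarith)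
  have h2 := Real.Gamma_pos_of_pos (show 0 < α / 2 by linarith)
  have := Real.pi_pos
  positivity

theorem rieszKernel_nonneg (hα₀ : 0 < α) (hαN : α < (N : ℝ)) (x : EuclideanSpace ℝ (Fin N)) :
    0 ≤ rieszKernel N α x :=
  mul_nonneg (rieszKernel_const_pos hα₀ hαN).le (by positivity)

theorem rieszKernel_neg (x : EuclideanSpace ℝ (Fin N)) :
    rieszKernel N α (-x) = rieszKernel N α x := by
  simp [rieszKernel]

theorem measurable_rieszKernel : Measurable (rieszKernel N α) := by
  unfold rieszKernel
  fun_prop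

/-- Superlevel sets lie in balls of radius proportional to `t ^ (-1 / (N - α))`, whose volume is the
`N`-th power of the radius up to a constant: the kernel is in weak `L^(N/(N-α))`. -/
theorem exists_meas_lt_rieszKernel_le (hα₀ : 0 < α) (hαN : α < (N : ℝ)) :
    ∃ c : ℝ, 0 ≤ c ∧ ∀ (x : EuclideanSpace ℝ (Fin N)) (t : ℝ), 0 < t →
      volume {y | t < rieszKernel N α (y - x)} ≤ ENNReal.ofReal (c * t ^ (-((N : ℝ) / (N - α)))) := by
  have hN : 0 < N := by
    have : (0 : ℝ) < N := hα₀.trans hαN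
    exact_mod_cast this
  have : Nonempty (Fin N) := ⟨⟨0, hN⟩⟩
  have hA := rieszKernel_const_pos hα₀ hαN
  set A := Real.Gamma (((N : ℝ) - α) / 2) /
      (Real.Gamma (α / 2) * Real.pi ^ ((N : ℝ) / 2) * (2 : ℝ) ^ α) with hAdef
  have hl : 0 < (N : ℝ) - α := by linarith
  set V := volume (Metric.ball (0 : EuclideanSpace ℝ (Fin N)) 1) with hV
  have hVfin : V ≠ ⊤ := measure_ball_lt_top.ne
  refine ⟨A ^ ((N : ℝ) / (N - α)) * V.toReal, by positivity, fun x t ht => ?_⟩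
  have hsub : {y | t < rieszKernel N α (y - x)} ⊆ Metric.ball x ((A / t) ^ (1 / ((N : ℝ) - α))) := by
    intro y hy
    have hy' : t < A * (1 / ‖y - x‖ ^ ((N : ℝ) - α)) := hy
    rw [mem_ball_iff_norm]
    -- At the singularity the kernel takes the default value `0`, so the centre is not in the
    -- superlevel set.
    have hpos : 0 < ‖y - x‖ ^ ((N : ℝ) - α) := by
      by_contra! h0
      have : ‖y - x‖ ^ ((N : ℝ) - α) = 0 := le_antisymm h0 (by positivity)
      rw [this] at hy'
      simp at hy'
      linarith
    have h1 : ‖y - x‖ ^ ((N : ℝ) - α) < A / t := by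
      rw [mul_one_div, lt_div_iff₀ hpos] at hy'
      rw [lt_div_iff₀ ht]
      linarith
    calc ‖y - x‖ = (‖y - x‖ ^ ((N : ℝ) - α)) ^ (1 / ((N : ℝ) - α)) := by
          rw [← Real.rpow_mul (norm_nonneg _), mul_one_div_cancel hl.ne', Real.rpow_one]
      _ < _ := Real.rpow_lt_rpow hpos.le h1 (by positivity)
  refine (measure_mono hsub).trans (le_of_eq ?_)
  rw [Measure.addHaar_ball _ _ (by positivity), ← hV, finrank_euclideanSpace_fin,
    ← ENNReal.ofReal_toReal hVfin, ← ENNReal.ofReal_mul (by positivity),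
    ENNReal.toReal_ofReal ENNReal.toReal_nonneg]
  congr 1
  rw [← Real.rpow_natCast, ← Real.rpow_mul (by positivity), Real.div_rpow hA.le ht.le,
    Real.rpow_neg ht.le, show 1 / ((N : ℝ) - α) * N = N / (N - α) by ring]
  ring

variable {f g : EuclideanSpace ℝ (Fin N) → ℝ}

theorem rieszConv_apply (x : EuclideanSpace ℝ (Fin N)) :
    rieszConv N α f x = ∫ y, rieszKernel N α (x - y) * f y :=
  convolution_mul_swap

theorem aestronglyMeasurable_rieszConv (hf : AEStronglyMeasurable f volume) :
    AEStronglyMeasurable (rieszConv N α f) volume :=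
  (AEStronglyMeasurable.convolution_integrand (ContinuousLinearMap.mul ℝ ℝ)
    measurable_rieszKernel.aestronglyMeasurable hf).integral_prod_right'

/-- The mapping property `L^θ₁ → L^θ₂'` of the Riesz potential. -/
theorem exists_rieszConv_bound (hα₀ : 0 < α) (hαN : α < (N : ℝ)) {θ₁ θ₂ θ₂' : ℝ}
    (hθ₁ : 1 < θ₁) (hθ₂ : θ₂.HolderConjugate θ₂')
    (hθ : 1 / θ₁ + 1 / θ₂ = ((N : ℝ) + α) / (N : ℝ)) :
    ∃ C : ℝ, 0 ≤ C ∧ ∀ (f : EuclideanSpace ℝ (Fin N) → ℝ) (a : ℝ), 0 < a →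
      AEStronglyMeasurable f volume → eLpNorm f (ENNReal.ofReal θ₁) volume ≤ ENNReal.ofReal a →
      (∀ᵐ x, ConvolutionExistsAt (rieszKernel N α) f x (ContinuousLinearMap.mul ℝ ℝ) volume) ∧
      MemLp (rieszConv N α f) (ENNReal.ofReal θ₂') volume ∧
      eLpNorm (rieszConv N α f) (ENNReal.ofReal θ₂') volume ≤ ENNReal.ofReal (C * a) := by
  have hN : (0 : ℝ) < N := hα₀.trans hαN
  have hl : 0 < (N : ℝ) - α := by linarith
  have hm : 1 < (N : ℝ) / (N - α) := by
    rw [one_lt_div hl]; linarith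
  -- With `m = N / (N - α)`, `1 / m = 1 - α / N` complements the sum `1 + α / N` given by the
  -- hypothesis.
  have hpr : 1 / θ₁ + 1 / θ₂ + 1 / ((N : ℝ) / (N - α)) = 2 := by
    rw [hθ]; field_simp; ring
  obtain ⟨c, hc, hw⟩ := exists_meas_lt_rieszKernel_le hα₀ hαN
  have hk : Measurable (Function.uncurry fun x y : EuclideanSpace ℝ (Fin N) =>
      rieszKernel N α (y - x)) :=
    measurable_rieszKernel.comp (measurable_snd.sub measurable_fst)
  have hsymm : ∀ x y : EuclideanSpace ℝ (Fin N),
      rieszKernel N α (y - x) = rieszKernel N α (x - y) := fun x y => by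
    rw [← rieszKernel_neg, neg_sub]
  obtain ⟨C, hC, hHLS⟩ := hardyLittlewoodSobolev (μ := volume) hk
    (fun x y => rieszKernel_nonneg hα₀ hαN _) hm hc hw
    (fun y t ht => by simp_rw [hsymm _ y]; exact hw y t ht) hθ₁ hθ₂.lt hpr
  refine ⟨C, hC, fun f a ha hf hfa => ?_⟩
  have hθ₁0 : 0 < θ₁ := by linarith
  have hθ₂'0 := hθ₂.symm.pos
  set F := fun x => |hf.mk f x| with hF
  have hFm : Measurable F := hf.stronglyMeasurable_mk.measurable.abs
  have hFf : ∀ᵐ x, ENNReal.ofReal (F x) = ‖f x‖ₑ := by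
    filter_upwards [hf.ae_eq_mk] with x hx
    rw [hF, hx, Real.enorm_eq_ofReal_abs]
  have hFp : ∫⁻ x, ENNReal.ofReal (F x ^ θ₁) ≤ ENNReal.ofReal (a ^ θ₁) := by
    rw [eLpNorm_eq_lintegral_rpow_enorm_toReal (by simpa using hθ₁0) (by simp),
      ENNReal.toReal_ofReal hθ₁0.le] at hfa
    have := ENNReal.rpow_le_rpow hfa hθ₁0.le
    rw [← ENNReal.rpow_mul, one_div_mul_cancel hθ₁0.ne', ENNReal.rpow_one,
      ENNReal.ofReal_rpow_of_pos ha] at this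
    refine le_trans (le_of_eq (lintegral_congr_ae ?_)) this
    filter_upwards [hFf] with x hx
    rw [← hx, ENNReal.ofReal_rpow_of_nonneg (abs_nonneg _) hθ₁0.le]
  -- `H` is the potential of `|f|` with values in `[0, ∞]`. Bounding it in `L^θ₂'` by duality gives
  -- both the norm estimate and, through finiteness almost everywhere, absolute convergence.
  set H := fun y => ∫⁻ x, ENNReal.ofReal (F x) * ENNReal.ofReal (rieszKernel N α (y - x)) with hH
  have hHm : Measurable H := by
    have : Measurable (Function.uncurry fun y x : EuclideanSpace ℝ (Fin N) =>
        ENNReal.ofReal (F x) * ENNReal.ofReal (rieszKernel N α (y - x))) :=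
      (hFm.ennreal_ofReal.comp measurable_snd).mul
        (measurable_rieszKernel.ennreal_ofReal.comp (measurable_fst.sub measurable_snd))
    exact this.lintegral_prod_right
  have hHr : ∫⁻ y, H y ^ θ₂' ≤ ENNReal.ofReal ((C * a) ^ θ₂') :=
    lintegral_rpow_le_of_forall_lintegral_mul_le hHm hθ₂ (by positivity)
      fun h b hb hh0 hhm hhb => hHLS F h a b ha hb (fun x => abs_nonneg _) hFm hh0 hhm hFp hhb
  have hHfin : ∀ᵐ y, H y < ⊤ := by
    have := ae_lt_top (hHm.pow_const θ₂') (hHr.trans_lt ENNReal.ofReal_lt_top).ne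
    filter_upwards [this] with y hy
    by_contra h
    rw [not_lt_top_iff] at h
    simp [h, ENNReal.top_rpow_of_pos hθ₂'0] at hy
  have hHe : ∀ y, ∫⁻ x, ‖rieszKernel N α (y - x) * f x‖ₑ = H y := by
    intro y
    refine lintegral_congr_ae ?_
    filter_upwards [hFf] with x hx
    rw [enorm_mul, ← hx, Real.enorm_of_nonneg (rieszKernel_nonneg hα₀ hαN _), mul_comm]
  have hconvm := aestronglyMeasurable_rieszConv (α := α) hf
  have hle : eLpNorm (rieszConv N α f) (ENNReal.ofReal θ₂') volume ≤ ENNReal.ofReal (C * a) := by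
    rw [eLpNorm_eq_lintegral_rpow_enorm_toReal (by simpa using hθ₂'0) (by simp),
      ENNReal.toReal_ofReal hθ₂'0.le]
    calc _ ≤ (∫⁻ y, H y ^ θ₂') ^ (1 / θ₂') := by
          refine ENNReal.rpow_le_rpow (lintegral_mono fun y => ?_) (by positivity)
          refine ENNReal.rpow_le_rpow ?_ hθ₂'0.le
          rw [rieszConv_apply, ← hHe]
          exact enorm_integral_le_lintegral_enorm _
      _ ≤ (ENNReal.ofReal ((C * a) ^ θ₂')) ^ (1 / θ₂') :=
          ENNReal.rpow_le_rpow hHr (by positivity)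
      _ = _ := by
          rw [← ENNReal.ofReal_rpow_of_nonneg (by positivity) hθ₂'0.le, ← ENNReal.rpow_mul,
            mul_one_div_cancel hθ₂'0.ne', ENNReal.rpow_one]
  refine ⟨?_, ⟨hconvm, hle.trans_lt ENNReal.ofReal_lt_top⟩, hle⟩
  filter_upwards [hHfin] with y hy
  rw [convolutionExistsAt_iff_integrable_swap]
  refine ⟨AEStronglyMeasurable.convolution_integrand_swap_snd (ContinuousLinearMap.mul ℝ ℝ)
    measurable_rieszKernel.aestronglyMeasurable hf y, ?_⟩
  rw [HasFiniteIntegral]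
  simp only [ContinuousLinearMap.mul_apply']
  rw [hHe]
  exact hy

theorem rieszConv_sub {x : EuclideanSpace ℝ (Fin N)}
    (hf : ConvolutionExistsAt (rieszKernel N α) f x (ContinuousLinearMap.mul ℝ ℝ) volume)
    (hg : ConvolutionExistsAt (rieszKernel N α) g x (ContinuousLinearMap.mul ℝ ℝ) volume) :
    rieszConv N α (f - g) x = rieszConv N α f x - rieszConv N α g x := by
  simp only [rieszConv, convolution_def, Pi.sub_apply, map_sub]
  exact integral_sub hf.integrable hg.integrable

end RieszKernel

/-! ### Hölder, Fatou, dominated and weak convergence in `L^p`. -/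

section LpTools

variable {X : Type*} [MeasurableSpace X] {μ : Measure X}

theorem abs_integral_mul_le {p q : ℝ} (hpq : p.HolderConjugate q) {f g : X → ℝ} {A B : ℝ}
    (hA : 0 ≤ A) (hB : 0 ≤ B) (hf : AEStronglyMeasurable f μ) (hg : AEStronglyMeasurable g μ)
    (hfA : eLpNorm f (ENNReal.ofReal p) μ ≤ ENNReal.ofReal A)
    (hgB : eLpNorm g (ENNReal.ofReal q) μ ≤ ENNReal.ofReal B) :
    |∫ x, f x * g x ∂μ| ≤ A * B := by
  have := hpq.ennrealOfReal
  have h1 : ‖∫ x, f x * g x ∂μ‖ₑ ≤ ENNReal.ofReal (A * B) := by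
    calc _ ≤ ∫⁻ x, ‖f x * g x‖ₑ ∂μ := enorm_integral_le_lintegral_enorm _
      _ = eLpNorm (f • g) 1 μ := by rw [eLpNorm_one_eq_lintegral_enorm]; rfl
      _ ≤ _ := eLpNorm_smul_le_mul_eLpNorm (p := ENNReal.ofReal p) (q := ENNReal.ofReal q) hg hf
      _ ≤ ENNReal.ofReal A * ENNReal.ofReal B := mul_le_mul' hfA hgB
      _ = _ := (ENNReal.ofReal_mul hA).symm
  rw [Real.enorm_eq_ofReal_abs] at h1
  exact (ENNReal.ofReal_le_ofReal_iff (by positivity)).1 h1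

theorem MeasureTheory.MemLp.integrable_mul_of_holderConjugate {p q : ℝ}
    (hpq : p.HolderConjugate q) {f g : X → ℝ}
    (hf : MemLp f (ENNReal.ofReal p) μ) (hg : MemLp g (ENNReal.ofReal q) μ) :
    Integrable (fun x => f x * g x) μ := by
  have := hpq.ennrealOfReal
  exact hf.integrable_mul hg

theorem eLpNorm_le_of_tendsto_ae {E : Type*} [NormedAddCommGroup E] {p : ENNReal} {f : ℕ → X → E}
    {g : X → E} {B : ENNReal} (hf : ∀ n, AEStronglyMeasurable (f n) μ)
    (hB : ∀ n, eLpNorm (f n) p μ ≤ B)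
    (h : ∀ᵐ x ∂μ, Tendsto (fun n => f n x) atTop (𝓝 (g x))) : eLpNorm g p μ ≤ B := by
  refine (Lp.eLpNorm_lim_le_liminf_eLpNorm hf g h).trans ?_
  exact (liminf_le_liminf (Eventually.of_forall hB)).trans (liminf_const B).le

/-- Dominated convergence in `L^p`. -/
theorem tendsto_eLpNorm_zero_of_dominated {p : ℝ} (hp : 0 < p) {F : ℕ → X → ℝ} {G : X → ℝ}
    (hF : ∀ n, AEStronglyMeasurable (F n) μ) (hG : MemLp G (ENNReal.ofReal p) μ)
    (hFG : ∀ n, ∀ᵐ x ∂μ, |F n x| ≤ |G x|)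
    (hlim : ∀ᵐ x ∂μ, Tendsto (fun n => F n x) atTop (𝓝 0)) :
    Tendsto (fun n => eLpNorm (F n) (ENNReal.ofReal p) μ) atTop (𝓝 0) := by
  have hp0 : ENNReal.ofReal p ≠ 0 := by simpa using hp
  simp_rw [eLpNorm_eq_lintegral_rpow_enorm_toReal hp0 ENNReal.ofReal_ne_top,
    ENNReal.toReal_ofReal hp.le]
  have h1 : Tendsto (fun n => ∫⁻ x, ‖F n x‖ₑ ^ p ∂μ) atTop (𝓝 (∫⁻ _, 0 ∂μ)) := by
    refine tendsto_lintegral_of_dominated_convergence' (fun x => ‖G x‖ₑ ^ p)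
      (fun n => (hF n).enorm.pow_const p) (fun n => ?_) ?_ ?_
    · filter_upwards [hFG n] with x hx
      refine ENNReal.rpow_le_rpow ?_ hp.le
      rw [Real.enorm_eq_ofReal_abs, Real.enorm_eq_ofReal_abs]
      exact ENNReal.ofReal_le_ofReal hx
    · have := lintegral_rpow_enorm_lt_top_of_eLpNorm_lt_top hp0 ENNReal.ofReal_ne_top
        hG.eLpNorm_lt_top
      rw [ENNReal.toReal_ofReal hp.le] at this
      exact this.ne
    · filter_upwards [hlim] with x hx
      have h2 := ((ENNReal.continuous_rpow_const (y := p)).tendsto _).comp hx.enorm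
      simpa [Function.comp_def, ENNReal.zero_rpow_of_pos hp] using h2
  rw [lintegral_zero] at h1
  have h2 := ((ENNReal.continuous_rpow_const (y := 1 / p)).tendsto _).comp h1
  rw [ENNReal.zero_rpow_of_pos (by positivity)] at h2
  exact h2

/-- A bounded sequence in `L^q`, `1 < q < ∞`, converging to zero almost everywhere converges weakly
to zero. -/
theorem tendsto_integral_mul_zero_of_bounded {p q : ℝ} (hpq : p.HolderConjugate q) {H : X → ℝ}
    {g : ℕ → X → ℝ} {B : ℝ} (hB : 0 ≤ B) (hH : MemLp H (ENNReal.ofReal p) μ)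
    (hg : ∀ n, AEStronglyMeasurable (g n) μ)
    (hgB : ∀ n, eLpNorm (g n) (ENNReal.ofReal q) μ ≤ ENNReal.ofReal B)
    (hlim : ∀ᵐ x ∂μ, Tendsto (fun n => g n x) atTop (𝓝 0)) :
    Tendsto (fun n => ∫ x, H x * g n x ∂μ) atTop (𝓝 0) := by
  have hp0 := hpq.pos
  have hgL : ∀ n, MemLp (g n) (ENNReal.ofReal q) μ := fun n =>
    ⟨hg n, (hgB n).trans_lt ENNReal.ofReal_lt_top⟩
  have hHint : Integrable (fun x => |H x| ^ p) μ := by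
    have := hH.integrable_norm_rpow (by simpa using hp0) ENNReal.ofReal_ne_top
    rwa [ENNReal.toReal_ofReal hp0.le] at this
  set M := ∫ x, |H x| ^ p ∂μ with hM
  have hM0 : 0 ≤ M := integral_nonneg fun x => by positivity
  rw [Metric.tendsto_atTop]
  intro δ hδ
  set ε := δ / (2 * (M + 1)) with hε
  have hε0 : 0 < ε := by positivity
  have hεM : ε * M < δ / 2 := by
    rw [hε, div_mul_eq_mul_div, div_lt_div_iff₀ (by positivity) (by positivity)]
    nlinarith
  -- `K n` equals `|H|` where `|g n| ≥ ε |H| ^ (p - 1)` and `H ≠ 0`; elsewhere `|H g n| ≤ ε |H| ^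
  -- p`. Being dominated by `|H|` and tending to zero almost everywhere, it tends to zero in `L^p`,
  -- so Hölder with the bound on `g n` controls `∫ K n |g n|`.
  set K : ℕ → X → ℝ := fun n x => |H x| * min 1 (|g n x| / (ε * |H x| ^ (p - 1))) with hK
  have hKm : ∀ n, AEStronglyMeasurable (K n) μ := fun n => by
    have h1 : AEMeasurable H μ := hH.1.aemeasurable
    have h2 : AEMeasurable (g n) μ := (hg n).aemeasurable
    have : AEMeasurable (K n) μ := by fun_prop
    exact this.aestronglyMeasurable
  have hK0 : ∀ n x, 0 ≤ K n x := fun n x => by positivity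
  have hKH : ∀ n x, |K n x| ≤ |H x| := fun n x => by
    rw [abs_of_nonneg (hK0 n x)]
    exact mul_le_of_le_one_right (abs_nonneg _) (min_le_left _ _)
  have hKlim : ∀ᵐ x ∂μ, Tendsto (fun n => K n x) atTop (𝓝 0) := by
    filter_upwards [hlim] with x hx
    have h1 : Tendsto (fun n => |g n x| / (ε * |H x| ^ (p - 1))) atTop (𝓝 0) := by
      simpa using hx.abs.div_const (ε * |H x| ^ (p - 1))
    have h2 := ((tendsto_const_nhds (x := (1 : ℝ))).min h1).const_mul |H x|
    simpa using h2
  have hKt := tendsto_eLpNorm_zero_of_dominated hp0 hKm hH (fun n => Eventually.of_forall (hKH n))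
    hKlim
  have hη : 0 < δ / (2 * (B + 1)) := by positivity
  have hev := (ENNReal.tendsto_nhds_zero.1 hKt) (ENNReal.ofReal (δ / (2 * (B + 1))))
    (by simpa using hη)
  obtain ⟨n₀, hn₀⟩ := eventually_atTop.1 hev
  refine ⟨n₀, fun n hn => ?_⟩
  rw [dist_zero_right, Real.norm_eq_abs]
  have hKL : MemLp (K n) (ENNReal.ofReal p) μ :=
    ⟨hKm n, (hn₀ n hn).trans_lt ENNReal.ofReal_lt_top⟩
  have hpt : ∀ x, |H x * g n x| ≤ ε * |H x| ^ p + K n x * |g n x| := by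
    intro x
    rcases eq_or_lt_of_le (abs_nonneg (H x)) with h0 | h0
    · rw [abs_mul, ← h0, zero_mul]
      have := hK0 n x
      positivity
    have hφ : 0 < ε * |H x| ^ (p - 1) := by positivity
    rw [abs_mul]
    rcases le_total (ε * |H x| ^ (p - 1)) |g n x| with h | h
    · have : K n x = |H x| := by
        rw [hK]
        simp only
        rw [min_eq_left ((one_le_div hφ).2 h), mul_one]
      rw [this]
      have : 0 ≤ ε * |H x| ^ p := by positivity
      linarith
    · have h1 : |H x| * |g n x| ≤ |H x| * (ε * |H x| ^ (p - 1)) := by gcongr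
      have h2 : |H x| * (ε * |H x| ^ (p - 1)) = ε * |H x| ^ p := by
        rw [mul_left_comm, mul_comm |H x|, ← Real.rpow_add_one h0.ne', sub_add_cancel]
      have := mul_nonneg (hK0 n x) (abs_nonneg (g n x))
      linarith
  have hgabs : eLpNorm (fun x => |g n x|) (ENNReal.ofReal q) μ ≤ ENNReal.ofReal B :=
    (eLpNorm_norm (g n)).trans_le (hgB n)
  have hKg : Integrable (fun x => K n x * |g n x|) μ := hKL.integrable_mul_of_holderConjugate hpq (hgL n).abs
  calc |∫ x, H x * g n x ∂μ| ≤ ∫ x, |H x * g n x| ∂μ := abs_integral_le_integral_abs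
    _ ≤ ∫ x, (ε * |H x| ^ p + K n x * |g n x|) ∂μ :=
        integral_mono (hH.integrable_mul_of_holderConjugate hpq (hgL n)).abs
          ((hHint.const_mul ε).add hKg) hpt
    _ = ε * M + ∫ x, K n x * |g n x| ∂μ := by
        rw [integral_add (hHint.const_mul ε) hKg, integral_const_mul]
    _ ≤ ε * M + δ / (2 * (B + 1)) * B := by
        gcongr
        exact (le_abs_self _).trans
          (abs_integral_mul_le hpq hη.le hB (hKm n) (hgL n).abs.1 (hn₀ n hn) hgabs)
    _ < δ := by
        have : δ / (2 * (B + 1)) * B ≤ δ / 2 := by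
          rw [div_mul_eq_mul_div, div_le_div_iff₀ (by positivity) (by positivity)]
          nlinarith
        linarith

/-- A bounded sequence in `L^q`, `1 < q < ∞`, converging almost everywhere converges weakly. -/
theorem tendsto_integral_mul_of_bounded {p q : ℝ} (hpq : p.HolderConjugate q) {H : X → ℝ}
    {g : ℕ → X → ℝ} {g' : X → ℝ} {B : ℝ} (hB : 0 ≤ B) (hH : MemLp H (ENNReal.ofReal p) μ)
    (hg : ∀ n, AEStronglyMeasurable (g n) μ)
    (hgB : ∀ n, eLpNorm (g n) (ENNReal.ofReal q) μ ≤ ENNReal.ofReal B)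
    (hlim : ∀ᵐ x ∂μ, Tendsto (fun n => g n x) atTop (𝓝 (g' x))) :
    Tendsto (fun n => ∫ x, H x * g n x ∂μ) atTop (𝓝 (∫ x, H x * g' x ∂μ)) := by
  have hg'm : AEStronglyMeasurable g' μ := aestronglyMeasurable_of_tendsto_ae atTop hg hlim
  have hg'B := eLpNorm_le_of_tendsto_ae hg hgB hlim
  have hgL : ∀ n, MemLp (g n) (ENNReal.ofReal q) μ := fun n =>
    ⟨hg n, (hgB n).trans_lt ENNReal.ofReal_lt_top⟩
  have hg'L : MemLp g' (ENNReal.ofReal q) μ := ⟨hg'm, hg'B.trans_lt ENNReal.ofReal_lt_top⟩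
  have h := tendsto_integral_mul_zero_of_bounded hpq (B := B + B) (by positivity) hH
    (fun n => (hg n).sub hg'm)
    (fun n => (eLpNorm_sub_le (hg n) hg'm (by simpa using hpq.symm.lt.le)).trans (by
      rw [ENNReal.ofReal_add hB hB]
      exact add_le_add (hgB n) hg'B))
    (by
      filter_upwards [hlim] with x hx
      simpa using hx.sub_const (g' x))
  rw [← tendsto_sub_nhds_zero_iff]
  refine h.congr fun n => ?_
  rw [← integral_sub (hH.integrable_mul_of_holderConjugate hpq (hgL n))
    (hH.integrable_mul_of_holderConjugate hpq hg'L)]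
  simp only [Pi.sub_apply, mul_sub]

end LpTools

/-! ### The Brezis-Lieb lemma in `L^θ`. -/

section BrezisLieb

/-- By homogeneity only the ratio of the norms matters. If `‖b‖` is small relative to `‖a‖`,
continuity of `t ^ p` at `1` gives the `ε` term; otherwise every term is controlled by `‖b‖ ^ p`. -/
theorem exists_abs_norm_add_rpow_sub_le {p ε : ℝ} (hp : 1 ≤ p) (hε : 0 < ε) :
    ∃ C : ℝ, 0 ≤ C ∧ ∀ {E : Type*} [NormedAddCommGroup E] (a b : E),
      |‖a + b‖ ^ p - ‖a‖ ^ p - ‖b‖ ^ p| ≤ ε * ‖a‖ ^ p + C * ‖b‖ ^ p := by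
  have hp0 : 0 < p := by linarith
  have hcont : ContinuousAt (fun t : ℝ => t ^ p) 1 :=
    Real.continuousAt_rpow_const _ _ (Or.inl one_ne_zero)
  obtain ⟨η, hη, hη'⟩ := Metric.continuousAt_iff.1 hcont ε hε
  set δ := η / 2 with hδ
  have hδ0 : 0 < δ := by positivity
  refine ⟨(1 / δ + 1) ^ p + 1, by positivity, fun a b => ?_⟩
  have htri : |‖a + b‖ - ‖a‖| ≤ ‖b‖ := by
    simpa using abs_norm_sub_norm_le (a + b) a
  have key : |‖a + b‖ ^ p - ‖a‖ ^ p| ≤ ε * ‖a‖ ^ p + (1 / δ + 1) ^ p * ‖b‖ ^ p := by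
    rcases le_or_gt (δ * ‖a‖) ‖b‖ with h | h
    · have h1 : ‖a‖ ≤ 1 / δ * ‖b‖ := by
        rw [one_div, inv_mul_eq_div, le_div_iff₀ hδ0]; linarith
      have h2 : ‖a + b‖ ≤ (1 / δ + 1) * ‖b‖ := by
        have := norm_add_le a b; linarith
      have h3 : ‖a + b‖ ^ p ≤ (1 / δ + 1) ^ p * ‖b‖ ^ p := by
        rw [← Real.mul_rpow (by positivity) (norm_nonneg _)]
        exact Real.rpow_le_rpow (norm_nonneg _) h2 hp0.le
      have h4 : ‖a‖ ^ p ≤ (1 / δ + 1) ^ p * ‖b‖ ^ p := by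
        rw [← Real.mul_rpow (by positivity) (norm_nonneg _)]
        refine Real.rpow_le_rpow (norm_nonneg _) ?_ hp0.le
        have := norm_nonneg b; linarith
      have h5 : 0 ≤ ε * ‖a‖ ^ p := by positivity
      have h6 : 0 ≤ ‖a + b‖ ^ p := by positivity
      have h7 : 0 ≤ ‖a‖ ^ p := by positivity
      rw [abs_le]; constructor <;> linarith
    · have ha : 0 < ‖a‖ := by
        by_contra! h0
        have : ‖a‖ = 0 := le_antisymm h0 (norm_nonneg _)
        rw [this, mul_zero] at h
        exact absurd h (not_lt.2 (norm_nonneg _))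
      have hd : dist (‖a + b‖ / ‖a‖) 1 < η := by
        rw [Real.dist_eq, div_sub_one ha.ne', abs_div, abs_of_pos ha, div_lt_iff₀ ha]
        have : δ * ‖a‖ < η * ‖a‖ := by rw [hδ]; nlinarith
        linarith
      have h1 := (hη' hd).le
      rw [Real.dist_eq, Real.one_rpow, Real.div_rpow (norm_nonneg _) (norm_nonneg _),
        div_sub_one (by positivity), abs_div, abs_of_pos (by positivity : 0 < ‖a‖ ^ p),
        div_le_iff₀ (by positivity)] at h1
      have : 0 ≤ (1 / δ + 1) ^ p * ‖b‖ ^ p := by positivity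
      linarith
  calc _ ≤ |‖a + b‖ ^ p - ‖a‖ ^ p| + |‖b‖ ^ p| := abs_sub _ _
    _ ≤ _ := by
      rw [abs_of_nonneg (by positivity : 0 ≤ ‖b‖ ^ p)]
      linarith

variable {X : Type*} [MeasurableSpace X] {μ : Measure X} {𝕜 : Type*} [NormedAddCommGroup 𝕜]

theorem eLpNorm_norm_rpow_le {p θ M : ℝ} (hp : 1 ≤ p) (hθ : 1 < θ) (hM : 0 ≤ M) {f : X → 𝕜}
    (h : eLpNorm f (ENNReal.ofReal (θ * p)) μ ≤ ENNReal.ofReal M) :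
    eLpNorm (fun x => ‖f x‖ ^ p) (ENNReal.ofReal θ) μ ≤ ENNReal.ofReal (M ^ p) := by
  rw [eLpNorm_norm_rpow _ (by linarith), ← ENNReal.ofReal_mul (by linarith),
    ← ENNReal.ofReal_rpow_of_nonneg hM (by linarith)]
  exact ENNReal.rpow_le_rpow h (by linarith)

/-- The Brezis-Lieb lemma: `|u n| ^ p - |u n - u'| ^ p` tends to `|u'| ^ p` in `L^θ`. -/
theorem tendsto_eLpNorm_brezisLieb {p θ M : ℝ} (hp : 1 ≤ p) (hθ : 1 < θ) (hM : 0 ≤ M)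
    {u : ℕ → X → 𝕜} {u' : X → 𝕜} (hu : ∀ n, AEStronglyMeasurable (u n) μ)
    (hu' : AEStronglyMeasurable u' μ)
    (huM : ∀ n, eLpNorm (u n - u') (ENNReal.ofReal (θ * p)) μ ≤ ENNReal.ofReal M)
    (hu'M : eLpNorm u' (ENNReal.ofReal (θ * p)) μ ≤ ENNReal.ofReal M)
    (hlim : ∀ᵐ x ∂μ, Tendsto (fun n => u n x) atTop (𝓝 (u' x))) :
    Tendsto (fun n => eLpNorm (fun x => ‖u n x‖ ^ p - ‖(u n - u') x‖ ^ p - ‖u' x‖ ^ p)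
      (ENNReal.ofReal θ) μ) atTop (𝓝 0) := by
  have hp0 : 0 < p := by linarith
  have hmp : ∀ {f : X → 𝕜}, AEStronglyMeasurable f μ →
      AEStronglyMeasurable (fun x => ‖f x‖ ^ p) μ := fun hf =>
    (hf.norm.aemeasurable.pow_const p).aestronglyMeasurable
  rw [ENNReal.tendsto_nhds_zero]
  intro δ hδ
  rcases eq_or_ne δ ⊤ with rfl | hδt
  · exact Eventually.of_forall fun _ => le_top
  have hδ' : 0 < δ.toReal := ENNReal.toReal_pos hδ.ne' hδt
  set ε := δ.toReal / (2 * (M ^ p + 1)) with hε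
  have hMp : 0 ≤ M ^ p := by positivity
  have hε0 : 0 < ε := by positivity
  have hεM : ε * M ^ p ≤ δ.toReal / 2 := by
    rw [hε, div_mul_eq_mul_div, div_le_div_iff₀ (by positivity) (by positivity)]
    nlinarith
  obtain ⟨C, hC, hCb⟩ := exists_abs_norm_add_rpow_sub_le hp hε0
  set F : ℕ → X → ℝ := fun n x => ‖u n x‖ ^ p - ‖(u n - u') x‖ ^ p - ‖u' x‖ ^ p with hF
  have hFm : ∀ n, AEStronglyMeasurable (F n) μ := fun n =>
    ((hmp (hu n)).sub (hmp ((hu n).sub hu'))).sub (hmp hu')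
  have hFb : ∀ n x, |F n x| ≤ ε * ‖(u n - u') x‖ ^ p + C * ‖u' x‖ ^ p := by
    intro n x
    have := hCb ((u n - u') x) (u' x)
    simpa [hF] using this
  -- The part of `|F n|` exceeding `ε |u n - u'| ^ p` is dominated by the fixed function `C |u'| ^
  -- p`, so dominated convergence applies to it; the rest is small in norm by the choice of `ε`.
  set W : ℕ → X → ℝ := fun n x => max (|F n x| - ε * ‖(u n - u') x‖ ^ p) 0 with hW
  have hWm : ∀ n, AEStronglyMeasurable (W n) μ := fun n =>
    (((hFm n).norm.sub ((hmp ((hu n).sub hu')).const_mul ε))).sup aestronglyMeasurable_const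
  have hFlim : ∀ᵐ x ∂μ, Tendsto (fun n => F n x) atTop (𝓝 0) := by
    filter_upwards [hlim] with x hx
    have h1 : Tendsto (fun n => ‖u n x‖ ^ p) atTop (𝓝 (‖u' x‖ ^ p)) :=
      hx.norm.rpow_const (Or.inr hp0.le)
    have h2 : Tendsto (fun n => ‖(u n - u') x‖ ^ p) atTop (𝓝 0) := by
      have := ((hx.sub_const (u' x)).norm).rpow_const (p := p) (Or.inr hp0.le)
      simpa [Real.zero_rpow hp0.ne'] using this
    have := (h1.sub h2).sub_const (‖u' x‖ ^ p)
    rwa [sub_zero, sub_self] at this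
  have hWlim : ∀ᵐ x ∂μ, Tendsto (fun n => W n x) atTop (𝓝 0) := by
    filter_upwards [hFlim] with x hx
    refine squeeze_zero (fun n => le_max_right _ _) (fun n => ?_) (by simpa using hx.abs)
    refine max_le ?_ (abs_nonneg _)
    have : 0 ≤ ε * ‖(u n - u') x‖ ^ p := by positivity
    linarith
  have hu'L : MemLp (fun x => C * ‖u' x‖ ^ p) (ENNReal.ofReal θ) μ :=
    MemLp.const_mul ⟨hmp hu', (eLpNorm_norm_rpow_le hp hθ hM hu'M).trans_lt
      ENNReal.ofReal_lt_top⟩ C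
  have hWb : ∀ n x, |W n x| ≤ |C * ‖u' x‖ ^ p| := by
    intro n x
    have h0 : 0 ≤ C * ‖u' x‖ ^ p := by positivity
    rw [abs_of_nonneg (le_max_right _ _ : 0 ≤ W n x), abs_of_nonneg h0]
    exact max_le (by linarith [hFb n x]) h0
  have hWt := tendsto_eLpNorm_zero_of_dominated (by linarith : 0 < θ) hWm hu'L
    (fun n => Eventually.of_forall (hWb n)) hWlim
  have hδ2 : 0 < ENNReal.ofReal (δ.toReal / 2) := by simpa using hδ'
  filter_upwards [(ENNReal.tendsto_nhds_zero.1 hWt) _ hδ2] with n hn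
  calc eLpNorm (F n) (ENNReal.ofReal θ) μ
      ≤ eLpNorm (W n + ε • fun x => ‖(u n - u') x‖ ^ p) (ENNReal.ofReal θ) μ := by
        refine eLpNorm_mono_real fun x => ?_
        have : |F n x| - ε * ‖(u n - u') x‖ ^ p ≤ W n x := le_max_left _ _
        simp only [Pi.add_apply, Pi.smul_apply, smul_eq_mul, Real.norm_eq_abs]
        linarith
    _ ≤ eLpNorm (W n) (ENNReal.ofReal θ) μ +
        eLpNorm (ε • fun x => ‖(u n - u') x‖ ^ p) (ENNReal.ofReal θ) μ :=
        eLpNorm_add_le (hWm n) ((hmp ((hu n).sub hu')).const_smul ε) (by simpa using hθ.le)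
    _ ≤ ENNReal.ofReal (δ.toReal / 2) + ENNReal.ofReal (δ.toReal / 2) := by
        refine add_le_add hn ?_
        rw [eLpNorm_const_smul, Real.enorm_of_nonneg hε0.le]
        calc _ ≤ ENNReal.ofReal ε * ENNReal.ofReal (M ^ p) := by
              gcongr
              exact eLpNorm_norm_rpow_le hp hθ hM (huM n)
          _ = ENNReal.ofReal (ε * M ^ p) := (ENNReal.ofReal_mul hε0.le).symm
          _ ≤ _ := ENNReal.ofReal_le_ofReal hεM
    _ = δ := by
        rw [← ENNReal.ofReal_add (by positivity) (by positivity), add_halves,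
          ENNReal.ofReal_toReal hδt]

end BrezisLieb

/-! ### The bilinear form of the Riesz potential: symmetry and continuity. -/

section RieszForm

variable {N : ℕ} {α : ℝ}

/-- The bilinear form `∫ (I_α * f) g` is symmetric. -/
theorem integral_rieszConv_mul_comm (hα₀ : 0 < α) (hαN : α < (N : ℝ)) {θ₁ θ₂ : ℝ}
    (hθ₁ : 1 < θ₁) (hθ₂ : 1 < θ₂) (hθ : 1 / θ₁ + 1 / θ₂ = ((N : ℝ) + α) / (N : ℝ))
    {f g : EuclideanSpace ℝ (Fin N) → ℝ} (hf : MemLp f (ENNReal.ofReal θ₁) volume)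
    (hg : MemLp g (ENNReal.ofReal θ₂) volume) :
    ∫ x, rieszConv N α f x * g x = ∫ x, rieszConv N α g x * f x := by
  have hθ₂' := Real.HolderConjugate.conjExponent hθ₂
  obtain ⟨C, hC, hCb⟩ := exists_rieszConv_bound hα₀ hαN hθ₁ hθ₂' hθ
  have ha : 0 < (eLpNorm f (ENNReal.ofReal θ₁) volume).toReal + 1 := by positivity
  have hfa : eLpNorm f (ENNReal.ofReal θ₁) volume ≤
      ENNReal.ofReal ((eLpNorm f (ENNReal.ofReal θ₁) volume).toReal + 1) := by
    refine (ENNReal.ofReal_toReal hf.2.ne).symm.trans_le (ENNReal.ofReal_le_ofReal (by linarith))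
  obtain ⟨hex, -, -⟩ := hCb f _ ha hf.1 hfa
  -- The bound for `|f|`, paired with `|g|`, supplies the absolute integrability that Fubini needs.
  obtain ⟨-, hL, -⟩ := hCb (fun x => |f x|) _ ha hf.abs.1 ((eLpNorm_norm f).trans_le hfa)
  have hint : Integrable (fun x => rieszConv N α (fun y => |f y|) x * |g x|) :=
    hL.integrable_mul_of_holderConjugate hθ₂'.symm hg.abs
  have hm : AEStronglyMeasurable (fun z : EuclideanSpace ℝ (Fin N) × EuclideanSpace ℝ (Fin N) =>
      rieszKernel N α (z.1 - z.2) * f z.2 * g z.1) (volume.prod volume) :=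
    (((measurable_rieszKernel.comp (measurable_fst.sub measurable_snd)).aestronglyMeasurable).mul
      hf.1.comp_snd).mul hg.1.comp_fst
  have hprod : Integrable (fun z : EuclideanSpace ℝ (Fin N) × EuclideanSpace ℝ (Fin N) =>
      rieszKernel N α (z.1 - z.2) * f z.2 * g z.1) (volume.prod volume) := by
    rw [integrable_prod_iff hm]
    constructor
    · filter_upwards [hex] with x hx
      rw [convolutionExistsAt_iff_integrable_swap] at hx
      exact hx.mul_const (g x)
    · refine hint.congr (Eventually.of_forall fun x => ?_)
      simp only [norm_mul, Real.norm_eq_abs, abs_of_nonneg (rieszKernel_nonneg hα₀ hαN _),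
        rieszConv_apply, integral_mul_const]
  calc _ = ∫ x, ∫ y, rieszKernel N α (x - y) * f y * g x := by
        simp only [rieszConv_apply, integral_mul_const]
    _ = ∫ y, ∫ x, rieszKernel N α (x - y) * f y * g x := integral_integral_swap hprod
    _ = _ := by
        refine integral_congr_ae (Eventually.of_forall fun y => ?_)
        simp only [rieszConv_apply, ← integral_mul_const]
        refine integral_congr_ae (Eventually.of_forall fun x => ?_)
        simp only
        rw [← rieszKernel_neg, neg_sub]
        ring

/-- `∫ (I_α * f n) (g n)` converges if `f n` converges strongly and `g n` is bounded and converges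
almost everywhere. -/
theorem tendsto_integral_rieszConv_mul (hα₀ : 0 < α) (hαN : α < (N : ℝ)) {θ₁ θ₂ : ℝ}
    (hθ₁ : 1 < θ₁) (hθ₂ : 1 < θ₂) (hθ : 1 / θ₁ + 1 / θ₂ = ((N : ℝ) + α) / (N : ℝ))
    {f g : ℕ → EuclideanSpace ℝ (Fin N) → ℝ} {f' g' : EuclideanSpace ℝ (Fin N) → ℝ} {B : ℝ}
    (hB : 0 ≤ B) (hf : ∀ n, MemLp (f n) (ENNReal.ofReal θ₁) volume)
    (hf' : MemLp f' (ENNReal.ofReal θ₁) volume)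
    (hlim : Tendsto (fun n => eLpNorm (f n - f') (ENNReal.ofReal θ₁) volume) atTop (𝓝 0))
    (hg : ∀ n, AEStronglyMeasurable (g n) volume)
    (hgB : ∀ n, eLpNorm (g n) (ENNReal.ofReal θ₂) volume ≤ ENNReal.ofReal B)
    (hglim : ∀ᵐ x, Tendsto (fun n => g n x) atTop (𝓝 (g' x))) :
    Tendsto (fun n => ∫ x, rieszConv N α (f n) x * g n x) atTop
      (𝓝 (∫ x, rieszConv N α f' x * g' x)) := by
  have hθ₂' := Real.HolderConjugate.conjExponent hθ₂
  obtain ⟨C, hC, hCb⟩ := exists_rieszConv_bound hα₀ hαN hθ₁ hθ₂' hθ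
  have hmem : ∀ {h : EuclideanSpace ℝ (Fin N) → ℝ}, MemLp h (ENNReal.ofReal θ₁) volume →
      (∀ᵐ x, ConvolutionExistsAt (rieszKernel N α) h x (ContinuousLinearMap.mul ℝ ℝ) volume) ∧
      MemLp (rieszConv N α h) (ENNReal.ofReal (Real.conjExponent θ₂)) volume := by
    intro h hh
    have ha : 0 < (eLpNorm h (ENNReal.ofReal θ₁) volume).toReal + 1 := by positivity
    obtain ⟨h1, h2, -⟩ := hCb h _ ha hh.1
      ((ENNReal.ofReal_toReal hh.2.ne).symm.trans_le (ENNReal.ofReal_le_ofReal (by linarith)))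
    exact ⟨h1, h2⟩
  have hgL : ∀ n, MemLp (g n) (ENNReal.ofReal θ₂) volume := fun n =>
    ⟨hg n, (hgB n).trans_lt ENNReal.ofReal_lt_top⟩
  have hweak := tendsto_integral_mul_of_bounded hθ₂'.symm hB (hmem hf').2 hg hgB hglim
  -- Split `f n = f' + (f n - f')`: `hweak` treats the first term, and the operator bound with
  -- Hölder the second.
  have hstrong : Tendsto (fun n => ∫ x, rieszConv N α (f n - f') x * g n x) atTop (𝓝 0) := by
    rw [Metric.tendsto_atTop]
    intro δ hδ
    have ha : 0 < δ / (2 * (C * B + 1)) := by positivity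
    obtain ⟨n₀, hn₀⟩ := eventually_atTop.1
      ((ENNReal.tendsto_nhds_zero.1 hlim) _ (ENNReal.ofReal_pos.2 ha))
    refine ⟨n₀, fun n hn => ?_⟩
    obtain ⟨-, h1, h2⟩ := hCb (f n - f') _ ha ((hf n).sub hf').1 (hn₀ n hn)
    rw [dist_zero_right, Real.norm_eq_abs]
    calc _ ≤ C * (δ / (2 * (C * B + 1))) * B :=
          abs_integral_mul_le hθ₂'.symm (by positivity) hB h1.1 (hg n) h2 (hgB n)
      _ = δ * (C * B) / (2 * (C * B + 1)) := by ring
      _ < δ := by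
          have : 0 ≤ C * B := by positivity
          rw [div_lt_iff₀ (by positivity)]
          nlinarith
  have hsum := hstrong.add hweak
  rw [zero_add] at hsum
  refine hsum.congr fun n => ?_
  rw [← integral_add ((hmem ((hf n).sub hf')).2.integrable_mul_of_holderConjugate hθ₂'.symm (hgL n))
    ((hmem hf').2.integrable_mul_of_holderConjugate hθ₂'.symm (hgL n))]
  refine integral_congr_ae ?_
  filter_upwards [(hmem (hf n)).1, (hmem hf').1] with x h1 h2
  rw [rieszConv_sub h1 h2]
  ring

/-- The potential of `|u| ^ p ∈ L^θ₁` lies in the dual exponent of `θ₂`, and `|v| ^ q ∈ L^θ₂`, so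
Hölder applies. -/
theorem choquardWellDefined_of_memLp {𝕜 : Type*} [RCLike 𝕜] (hα₀ : 0 < α) (hαN : α < (N : ℝ))
    {p q θ₁ θ₂ : ℝ} (hp : 1 ≤ p) (hq : 1 ≤ q) (hθ₁ : 1 < θ₁) (hθ₂ : 1 < θ₂)
    (hθ : 1 / θ₁ + 1 / θ₂ = ((N : ℝ) + α) / (N : ℝ))
    {u v : EuclideanSpace ℝ (Fin N) → 𝕜} (hu : MemLp u (ENNReal.ofReal (θ₁ * p)) volume)
    (hv : MemLp v (ENNReal.ofReal (θ₂ * q)) volume) : ChoquardWellDefined N α p q u v := by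
  have hθ₂' := Real.HolderConjugate.conjExponent hθ₂
  obtain ⟨C, hC, hCb⟩ := exists_rieszConv_bound hα₀ hαN hθ₁ hθ₂' hθ
  have hpow : ∀ {w : EuclideanSpace ℝ (Fin N) → 𝕜} {r θ : ℝ}, 1 ≤ r → 1 < θ →
      MemLp w (ENNReal.ofReal (θ * r)) volume →
      AEStronglyMeasurable (fun x => ‖w x‖ ^ r) volume ∧
      eLpNorm (fun x => ‖w x‖ ^ r) (ENNReal.ofReal θ) volume ≤ ENNReal.ofReal
        (((eLpNorm w (ENNReal.ofReal (θ * r)) volume).toReal + 1) ^ r) := by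
    intro w r θ hr hθ hw
    refine ⟨(hw.1.norm.aemeasurable.pow_const r).aestronglyMeasurable, ?_⟩
    exact eLpNorm_norm_rpow_le hr hθ (by positivity)
      ((ENNReal.ofReal_toReal hw.2.ne).symm.trans_le (ENNReal.ofReal_le_ofReal (by linarith)))
  obtain ⟨hum, hub⟩ := hpow hp hθ₁ hu
  obtain ⟨hvm, hvb⟩ := hpow hq hθ₂ hv
  obtain ⟨h1, h2, -⟩ := hCb _ _ (by positivity) hum hub
  exact ⟨h1, h2.integrable_mul_of_holderConjugate hθ₂'.symm
    ⟨hvm, hvb.trans_lt ENNReal.ofReal_lt_top⟩⟩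

end RieszForm

/-! ### The nonlocal Brezis-Lieb splitting. -/

theorem proposition4p2 {𝕜 : Type*} [RCLike 𝕜] (N : ℕ) (hN : 1 ≤ N)
    (α p q θ₁ θ₂ : ℝ) (hα₀ : 0 < α) (hαN : α < (N : ℝ)) (hp : 1 ≤ p) (hq : 1 ≤ q)
    (hθ₁ : 1 < θ₁) (hθ₂ : 1 < θ₂)
    (hθ : 1 / θ₁ + 1 / θ₂ = ((N : ℝ) + α) / (N : ℝ))
    (un vn : ℕ → EuclideanSpace ℝ (Fin N) → 𝕜) (u v : EuclideanSpace ℝ (Fin N) → 𝕜)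
    (hun : ∀ n, MemLp (un n) (ENNReal.ofReal (θ₁ * p)) volume)
    (hvn : ∀ n, MemLp (vn n) (ENNReal.ofReal (θ₂ * q)) volume)
    (hun_bdd : ∃ C : ℝ, ∀ n,
      eLpNorm (un n) (ENNReal.ofReal (θ₁ * p)) volume ≤ ENNReal.ofReal C)
    (hvn_bdd : ∃ C : ℝ, ∀ n,
      eLpNorm (vn n) (ENNReal.ofReal (θ₂ * q)) volume ≤ ENNReal.ofReal C)
    (hu : ∀ᵐ x : EuclideanSpace ℝ (Fin N), Tendsto (fun n => un n x) atTop (𝓝 (u x)))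
    (hv : ∀ᵐ x : EuclideanSpace ℝ (Fin N), Tendsto (fun n => vn n x) atTop (𝓝 (v x))) :
    (∀ n, ChoquardWellDefined N α p q (un n) (vn n)) ∧
    (∀ n, ChoquardWellDefined N α p q (un n - u) (vn n - v)) ∧
    ChoquardWellDefined N α p q u v ∧
    Tendsto
      (fun n => (∫ x, choquardDensity N α p q (un n) (vn n) x) -
        ∫ x, choquardDensity N α p q (un n - u) (vn n - v) x)
      atTop (𝓝 (∫ x, choquardDensity N α p q u v x)) := by
  have bounds : ∀ {r θ : ℝ} {w : ℕ → EuclideanSpace ℝ (Fin N) → 𝕜}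
      {w' : EuclideanSpace ℝ (Fin N) → 𝕜}, 1 ≤ r → 1 < θ →
      (∀ n, MemLp (w n) (ENNReal.ofReal (θ * r)) volume) →
      (∃ C : ℝ, ∀ n, eLpNorm (w n) (ENNReal.ofReal (θ * r)) volume ≤ ENNReal.ofReal C) →
      (∀ᵐ x, Tendsto (fun n => w n x) atTop (𝓝 (w' x))) →
      MemLp w' (ENNReal.ofReal (θ * r)) volume ∧ ∃ M : ℝ, 0 ≤ M ∧
        eLpNorm w' (ENNReal.ofReal (θ * r)) volume ≤ ENNReal.ofReal M ∧
        (∀ n, eLpNorm (w n) (ENNReal.ofReal (θ * r)) volume ≤ ENNReal.ofReal M) ∧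
        ∀ n, eLpNorm (w n - w') (ENNReal.ofReal (θ * r)) volume ≤ ENNReal.ofReal M := by
    rintro r θ w w' hr hθ hw ⟨C, hC⟩ hlim
    have hm : AEStronglyMeasurable w' volume :=
      aestronglyMeasurable_of_tendsto_ae atTop (fun n => (hw n).1) hlim
    have hC' : ∀ n, eLpNorm (w n) (ENNReal.ofReal (θ * r)) volume ≤ ENNReal.ofReal |C| :=
      fun n => (hC n).trans (ENNReal.ofReal_le_ofReal (le_abs_self C))
    have hw' := eLpNorm_le_of_tendsto_ae (fun n => (hw n).1) hC' hlim
    have hle : ENNReal.ofReal |C| ≤ ENNReal.ofReal (|C| + |C|) :=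
      ENNReal.ofReal_le_ofReal (by linarith [abs_nonneg C])
    refine ⟨⟨hm, hw'.trans_lt ENNReal.ofReal_lt_top⟩, |C| + |C|, by positivity, hw'.trans hle,
      fun n => (hC' n).trans hle, fun n => ?_⟩
    rw [ENNReal.ofReal_add (abs_nonneg C) (abs_nonneg C)]
    refine (eLpNorm_sub_le (hw n).1 hm ?_).trans (add_le_add (hC' n) hw')
    rw [ENNReal.one_le_ofReal]
    nlinarith
  obtain ⟨huL, M₁, hM₁, huM, hunM, hunuM⟩ := bounds hp hθ₁ hun hun_bdd hu
  obtain ⟨hvL, M₂, hM₂, hvM, hvnM, hvnvM⟩ := bounds hq hθ₂ hvn hvn_bdd hv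
  have wd₁ := fun n => choquardWellDefined_of_memLp hα₀ hαN hp hq hθ₁ hθ₂ hθ (hun n) (hvn n)
  have wd₂ := fun n => choquardWellDefined_of_memLp hα₀ hαN hp hq hθ₁ hθ₂ hθ
    ((hun n).sub huL) ((hvn n).sub hvL)
  refine ⟨wd₁, wd₂, choquardWellDefined_of_memLp hα₀ hαN hp hq hθ₁ hθ₂ hθ huL hvL, ?_⟩
  have hpow : ∀ {r θ M : ℝ} {w : EuclideanSpace ℝ (Fin N) → 𝕜}, 1 ≤ r → 1 < θ → 0 ≤ M →
      AEStronglyMeasurable w volume →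
      eLpNorm w (ENNReal.ofReal (θ * r)) volume ≤ ENNReal.ofReal M →
      MemLp (fun x => ‖w x‖ ^ r) (ENNReal.ofReal θ) volume := fun hr hθ hM hw h =>
    ⟨(hw.norm.aemeasurable.pow_const _).aestronglyMeasurable,
      (eLpNorm_norm_rpow_le hr hθ hM h).trans_lt ENNReal.ofReal_lt_top⟩
  have hf := fun n => hpow hp hθ₁ hM₁ (hun n).1 (hunM n)
  have hf₀ := fun n => hpow hp hθ₁ hM₁ ((hun n).sub huL).1 (hunuM n)
  have hf' := hpow hp hθ₁ hM₁ huL.1 huM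
  have hg := fun n => hpow hq hθ₂ hM₂ (hvn n).1 (hvnM n)
  have hg₀ := fun n => hpow hq hθ₂ hM₂ ((hvn n).sub hvL).1 (hvnvM n)
  have hg' := hpow hq hθ₂ hM₂ hvL.1 hvM
  have hBLu := tendsto_eLpNorm_brezisLieb hp hθ₁ hM₁ (fun n => (hun n).1) huL.1 hunuM huM hu
  have hBLv := tendsto_eLpNorm_brezisLieb hq hθ₂ hM₂ (fun n => (hvn n).1) hvL.1 hvnvM hvM hv
  have h1 := tendsto_integral_rieszConv_mul hα₀ hαN hθ₁ hθ₂ hθ (by positivity : 0 ≤ M₂ ^ q)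
    (fun n => (hf n).sub (hf₀ n)) hf' hBLu (fun n => (hg n).1)
    (fun n => eLpNorm_norm_rpow_le hq hθ₂ hM₂ (hvnM n)) (g' := fun x => ‖v x‖ ^ q)
    (by
      filter_upwards [hv] with x hx
      exact hx.norm.rpow_const (Or.inr (by linarith)))
  -- The roles of the two sequences are exchanged: the Brezis-Lieb difference of the `vn` is paired
  -- with `|un - u| ^ p`, whose almost everywhere limit is `0`.
  have h2 := tendsto_integral_rieszConv_mul hα₀ hαN hθ₂ hθ₁ ((add_comm _ _).trans hθ)
    (by positivity : 0 ≤ M₁ ^ p)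
    (fun n => (hg n).sub (hg₀ n)) hg' hBLv (fun n => (hf₀ n).1)
    (fun n => eLpNorm_norm_rpow_le hp hθ₁ hM₁ (hunuM n)) (g' := fun _ => 0)
    (by
      filter_upwards [hu] with x hx
      have := ((hx.sub_const (u x)).norm).rpow_const (p := p) (Or.inr (by linarith))
      simpa [Real.zero_rpow (by linarith : p ≠ 0)] using this)
  simp only [mul_zero, integral_zero] at h2
  have h3 := h1.add h2
  rw [add_zero] at h3
  refine h3.congr fun n => ?_
  -- The mixed term `(I_α * |un - u| ^ p) |vn| ^ q` occurs with opposite signs in `e1` and `e2` and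
  -- cancels in their sum.
  have wd₃ := choquardWellDefined_of_memLp hα₀ hαN hp hq hθ₁ hθ₂ hθ ((hun n).sub huL) (hvn n)
  have hi₁ : Integrable (fun x => rieszConv N α (fun y => ‖un n y‖ ^ p) x * ‖vn n x‖ ^ q) :=
    (wd₁ n).2
  have hi₂ : Integrable (fun x => rieszConv N α (fun y => ‖(un n - u) y‖ ^ p) x *
    ‖(vn n - v) x‖ ^ q) := (wd₂ n).2
  have hi₃ : Integrable (fun x => rieszConv N α (fun y => ‖(un n - u) y‖ ^ p) x *
    ‖vn n x‖ ^ q) := wd₃.2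
  have e1 : ∫ x, rieszConv N α ((fun y => ‖un n y‖ ^ p) - fun y => ‖(un n - u) y‖ ^ p) x *
      ‖vn n x‖ ^ q = (∫ x, rieszConv N α (fun y => ‖un n y‖ ^ p) x * ‖vn n x‖ ^ q) -
      ∫ x, rieszConv N α (fun y => ‖(un n - u) y‖ ^ p) x * ‖vn n x‖ ^ q := by
    rw [← integral_sub hi₁ hi₃]
    refine integral_congr_ae ?_
    filter_upwards [(wd₁ n).1, wd₃.1] with x hx1 hx2
    rw [rieszConv_sub hx1 hx2, sub_mul]
  have e2 : ∫ x, rieszConv N α ((fun y => ‖vn n y‖ ^ q) - fun y => ‖(vn n - v) y‖ ^ q) x *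
      ‖(un n - u) x‖ ^ p =
      (∫ x, rieszConv N α (fun y => ‖(un n - u) y‖ ^ p) x * ‖vn n x‖ ^ q) -
      ∫ x, rieszConv N α (fun y => ‖(un n - u) y‖ ^ p) x * ‖(vn n - v) x‖ ^ q := by
    rw [← integral_rieszConv_mul_comm hα₀ hαN hθ₁ hθ₂ hθ (hf₀ n) ((hg n).sub (hg₀ n)),
      ← integral_sub hi₃ hi₂]
    simp only [Pi.sub_apply, mul_sub]
  change _ + _ = (∫ x, rieszConv N α (fun y => ‖un n y‖ ^ p) x * ‖vn n x‖ ^ q) -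
    ∫ x, rieszConv N α (fun y => ‖(un n - u) y‖ ^ p) x * ‖(vn n - v) x‖ ^ q
  rw [e1, e2]
  ring
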